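/- Let $d\ge 1$, $\kappa>0$, $\alpha\in(0,1)$, $\delta>0$, and let $\chi\in L^\infty(\mathbb R)$ satisfy $\operatorname{supp}\chi\subset[-1,1]$, $0\le\chi\le1$ and $\chi=1$ on $[-\tfrac12,\tfrac12]$. Put $\chi_\delta(y)=\chi(|y|/\delta)$ for $y\in\mathbb R^d$, $$\omega_\delta(\xi)=\Big(\frac{\kappa}{\delta^{2(1-\alpha)}}\int_{\mathbb R^d}\chi_\delta(y)\,\frac{1-\cos(y\cdot\xi)}{|y|^{d+2\alpha}}\,dy\Big)^{1/2},$$ $$K_\delta[v](x)=-\frac{\kappa}{\delta^{2(1-\alpha)}}\,\mathrm{p.v.}\!\int_{\mathbb R^d}\chi_\delta(y)\,\frac{v(x)-v(x-y)}{|y|^{d+2\alpha}}\,dy,$$ and let $K_\delta^*$ be the dual operator, given by the same formula with $v(x+y)$ in place of $v(x-y)$ (it acts componentwise on vector fields). Let $\hat\varphi(\xi)=(2\pi)^{-d/2}\int_{\mathbb R^d}\varphi(x)e^{-ix\cdot\xi}\,dx$, extended to tempered distributions by duality, and for $r\in\mathbb R$ let $H^r=H^r(\mathbb R^d;\mathbb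 R^d)$ be the space of real-valued (that is, $\mathbb R^d$-valued) tempered distributions $u$ with $(1+|\xi|^2)^{r/2}\hat u\in L^2$, with the corresponding norm. Let $s\in\mathbb R$, $u_0\in H^s$ and $v_0\in H^{s-\alpha}$. Then there exists $u_\delta\in C([0,\infty);H^s)\cap C^1((0,\infty);H^{s-\alpha})$ such that, for every $t\in[0,\infty)$, $$\hat u_\delta(t,\cdot)=\cos(\omega_\delta t)\,\hat u_0+\frac{\sin(\omega_\delta t)}{\omega_\delta}\,\hat v_0,$$ where $\sin(\omega_\delta t)/\omega_\delta$ is read as $t$ where $\omega_\delta=0$. Here $\hat u_0$, $\hat v_0$ and $\hat u_\delta(t,\cdot)$ are functions, and the identity holds almost everywhere. Moreover, $u_\delta$ is a distributional solution of $\partial_{tt}u-K_\delta[u]=0$ with initial data $u(0,\cdot)=u_0$, $\partial_tu(0,\cdot)=v_0$, in the following sense. The formula $\langle u_\delta,\varphi\rangle=\int_0^\infty\langle u_\delta(t,\cdot),\varphi(t,\cdot)\rangle\,dt$ defines an $\mathbb R^d$-valued distribution on $\mathbb R\times\mathbb R^d$ with support in $[0,\infty)\times\mathbb R^d$. For every $\varphi\in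 C_c^\infty(\mathbb R\times\mathbb R^d)$ the function $\partial_{tt}\varphi-K_\delta^*[\varphi]$ is again in $C_c^\infty(\mathbb R\times\mathbb R^d)$, and $$\langle u_\delta,\partial_{tt}\varphi-K_\delta^*[\varphi]\rangle=-\langle u_0,\partial_t\varphi(0,\cdot)\rangle+\langle v_0,\varphi(0,\cdot)\rangle .$$ (The pairing of an $\mathbb R^d$-valued distribution with a scalar test function is taken componentwise and has values in $\mathbb R^d$.) -/

import Mathlib

open MeasureTheory Set Filter Topology TopologicalSpace
open scoped SchwartzMap Distributions FourierTransform LineDeriv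

noncomputable section

namespace Peridynamics

/-- The space `ℝ^d`, with the Euclidean norm. -/
abbrev Rd (d : ℕ) : Type := EuclideanSpace ℝ (Fin d)

/-- The space `ℂ^d`, with the Euclidean norm. -/
abbrev Cd (d : ℕ) : Type := EuclideanSpace ℂ (Fin d)

/-! ### The Fourier transform `φ̂(ξ) = (2π)^{-d/2} ∫ φ(x) e^{-i x·ξ} dx` -/

/-- The dilation `ξ ↦ (2π)⁻¹ ξ` of `ℝ^d`. -/
def dilation (d : ℕ) : Rd d ≃L[ℝ] Rd d :=
  ContinuousLinearEquiv.smulLeft (Units.mk0 (2 * Real.pi)⁻¹ (by positivity))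

/-- The Fourier transform on Schwartz functions, in the unitary angular-frequency normalization
(see `fourierS_apply` for the integral formula). -/
def fourierS (d : ℕ) : 𝓢(Rd d, ℂ) →L[ℂ] 𝓢(Rd d, ℂ) :=
  (((2 * Real.pi) ^ (-(d : ℝ) / 2) : ℝ) : ℂ) •
    ((SchwartzMap.compCLMOfContinuousLinearEquiv ℂ (dilation d)) ∘L
      (FourierTransform.fourierCLM ℂ 𝓢(Rd d, ℂ)))

theorem fourierS_apply (d : ℕ) (φ : 𝓢(Rd d, ℂ)) (ξ : Rd d) :
    fourierS d φ ξ = (((2 * Real.pi) ^ (-(d : ℝ) / 2) : ℝ) : ℂ) *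
      ∫ x : Rd d, φ x * Complex.exp (-Complex.I * ((inner ℝ x ξ : ℝ) : ℂ)) := by
  have h : fourierS d φ ξ = (((2 * Real.pi) ^ (-(d : ℝ) / 2) : ℝ) : ℂ) *
      (𝓕 (φ : Rd d → ℂ)) ((2 * Real.pi)⁻¹ • ξ) := by
    rw [← SchwartzMap.fourier_coe]
    rfl
  rw [h, Real.fourier_eq']
  congr 1
  refine integral_congr_ae (Eventually.of_forall fun x => ?_)
  simp only [smul_eq_mul]
  rw [mul_comm]
  congr 2
  rw [inner_smul_right]
  push_cast
  have : (Real.pi : ℂ) ≠ 0 := by exact_mod_cast Real.pi_ne_zero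
  field_simp

/-- The Fourier transform on tempered distributions, `⟨û, ψ⟩ = ⟨u, ψ̂⟩`. -/
def fourierT (d : ℕ) : 𝓢'(Rd d, Cd d) →L[ℂ] 𝓢'(Rd d, Cd d) :=
  PointwiseConvergenceCLM.precomp _ (fourierS d)

/-- The tempered distribution `T` is (given by integration against) the function `f`. -/
def IsGivenBy {d : ℕ} (T : 𝓢'(Rd d, Cd d)) (f : Rd d → Cd d) : Prop :=
  ∀ ψ : 𝓢(Rd d, ℂ), Integrable (fun x => ψ x • f x) ∧ T ψ = ∫ x, ψ x • f x

/-! ### The Hilbert spaces `H^s(ℝ^d; ℝ^d)` -/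

/-- Complex conjugation of Schwartz functions. -/
def conjS {d : ℕ} (ψ : 𝓢(Rd d, ℂ)) : 𝓢(Rd d, ℂ) :=
  SchwartzMap.postcompCLM (𝕜 := ℝ) (Complex.conjCLE : ℂ →L[ℝ] ℂ) ψ

/-- A `ℂ^d`-valued tempered distribution is real-valued. -/
def IsRealValued {d : ℕ} (u : 𝓢'(Rd d, Cd d)) : Prop :=
  ∀ (ψ : 𝓢(Rd d, ℂ)) (i : Fin d), u ψ i = (starRingEnd ℂ) (u (conjS ψ) i)

/-- The real vector space of real-valued tempered distributions in `H^s`. -/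
def sobolevSubmodule (d : ℕ) (s : ℝ) : Submodule ℝ 𝓢'(Rd d, Cd d) where
  carrier := {u | TemperedDistribution.MemSobolev s 2 u ∧ IsRealValued u}
  zero_mem' := ⟨TemperedDistribution.memSobolev_fun_zero _ _ s 2, fun ψ i => by simp⟩
  add_mem' := by
    rintro u v ⟨hu, hu'⟩ ⟨hv, hv'⟩
    refine ⟨hu.add hv, fun ψ i => ?_⟩
    simp [← hu' ψ i, ← hv' ψ i]
  smul_mem' := by
    rintro c u ⟨hu, hu'⟩
    refine ⟨?_, fun ψ i => ?_⟩
    · have := hu.smul (c : ℂ)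
      rwa [Complex.coe_smul] at this
    · change (c • (u ψ)) i = (starRingEnd ℂ) ((c • u (conjS ψ)) i)
      simp [← hu' ψ i]

/-- The space `H^s(ℝ^d; ℝ^d)`. It carries the Sobolev norm defined below, not the topology of
`𝓢'`. -/
def Hs (d : ℕ) (s : ℝ) : Type := sobolevSubmodule d s

variable {d : ℕ} {s : ℝ}

instance : AddCommGroup (Hs d s) := inferInstanceAs (AddCommGroup (sobolevSubmodule d s))

instance : Module ℝ (Hs d s) := inferInstanceAs (Module ℝ (sobolevSubmodule d s))

/-- The tempered distribution underlying an element of `H^s`. -/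
def Hs.toTempered : Hs d s →ₗ[ℝ] 𝓢'(Rd d, Cd d) := (sobolevSubmodule d s).subtype

theorem Hs.toTempered_injective : Function.Injective (Hs.toTempered (d := d) (s := s)) :=
  Subtype.val_injective

theorem Hs.memSobolev (u : Hs d s) : TemperedDistribution.MemSobolev s 2 u.toTempered := u.2.1

theorem Hs.isRealValued (u : Hs d s) : IsRealValued u.toTempered := u.2.2

theorem toTemperedDistribution_injective :
    Function.Injective (Lp.toTemperedDistributionCLM (Cd d) (volume : Measure (Rd d)) 2) :=
  LinearMap.ker_eq_bot.mp Lp.ker_toTemperedDistributionCLM_eq_bot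

/-- The `L²` function `⟨D⟩^s u`, obtained from `u ∈ H^s` by the Fourier multiplier
`(1 + |ξ|²)^{s/2}`. Here `ξ` is the frequency variable of Mathlib's Fourier transform
`∫ u(x) e^{-2πi x·ξ} dx`, which changes the norm below only to an equivalent one. -/
def Hs.besselFun (u : Hs d s) : Lp (Cd d) 2 (volume : Measure (Rd d)) := u.memSobolev.choose

theorem Hs.besselFun_spec (u : Hs d s) :
    TemperedDistribution.besselPotential (Rd d) (Cd d) s u.toTempered =
      Lp.toTemperedDistributionCLM (Cd d) (volume : Measure (Rd d)) 2 (Hs.besselFun u) :=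
  u.memSobolev.choose_spec

/-- The map `u ↦ ⟨D⟩^s u` from `H^s` to `L²` is linear. -/
def Hs.bessel : Hs d s →ₗ[ℝ] Lp (Cd d) 2 (volume : Measure (Rd d)) where
  toFun := Hs.besselFun
  map_add' u v := by
    apply toTemperedDistribution_injective
    rw [← Hs.besselFun_spec, map_add, map_add, map_add, Hs.besselFun_spec, Hs.besselFun_spec]
  map_smul' c u := by
    apply toTemperedDistribution_injective
    rw [← Hs.besselFun_spec, map_smul, ContinuousLinearMap.map_smul_of_tower, RingHom.id_apply,
      ContinuousLinearMap.map_smul_of_tower, Hs.besselFun_spec]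

theorem Hs.besselPotential_toTempered (u : Hs d s) :
    TemperedDistribution.besselPotential (Rd d) (Cd d) s u.toTempered =
      Lp.toTemperedDistributionCLM (Cd d) (volume : Measure (Rd d)) 2 (Hs.bessel u) :=
  Hs.besselFun_spec u

theorem Hs.bessel_injective : Function.Injective (Hs.bessel (d := d) (s := s)) := by
  intro u v h
  apply Hs.toTempered_injective
  have := congrArg (Lp.toTemperedDistributionCLM (Cd d) (volume : Measure (Rd d)) 2) h
  rw [← Hs.besselPotential_toTempered, ← Hs.besselPotential_toTempered] at this
  have h2 := congrArg (TemperedDistribution.besselPotential (Rd d) (Cd d) (-s)) this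
  simpa using h2

/-- The norm `‖u‖_{H^s} = ‖⟨D⟩^s u‖_{L²}`. -/
instance : NormedAddCommGroup (Hs d s) :=
  NormedAddCommGroup.induced (Hs d s) _ (Hs.bessel (d := d) (s := s)) Hs.bessel_injective

instance : NormedSpace ℝ (Hs d s) :=
  NormedSpace.induced ℝ (Hs d s) _ (Hs.bessel (d := d) (s := s))

theorem Hs.norm_eq (u : Hs d s) : ‖u‖ = ‖Hs.bessel u‖ := rfl

/-- The inclusion of `H^s` in `H^r` for `r ≤ s`. -/
def Hs.incl {r s : ℝ} (h : r ≤ s) (u : Hs d s) : Hs d r :=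
  ⟨u.toTempered, u.memSobolev.mono h, u.isRealValued⟩

/-! ### Distributions -/

/-- The whole space as an open set. -/
abbrev whole (E : Type*) [TopologicalSpace E] : Opens E := ⊤

/-- A real test function, regarded as a complex Schwartz function. -/
def testToSchwartzFun (φ : 𝓓(whole (Rd d), ℝ)) : 𝓢(Rd d, ℂ) :=
  HasCompactSupport.toSchwartzMap (f := fun x => ((φ x : ℝ) : ℂ))
    (φ.hasCompactSupport.comp_left Complex.ofReal_zero)
    (Complex.ofRealCLM.contDiff.comp φ.contDiff)

@[simp] theorem testToSchwartzFun_apply (φ : 𝓓(whole (Rd d), ℝ)) (x : Rd d) :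
    testToSchwartzFun φ x = (φ x : ℂ) := rfl

/-- The continuous inclusion of (real) test functions in (complex) Schwartz functions. -/
def testToSchwartz (d : ℕ) : 𝓓(whole (Rd d), ℝ) →L[ℝ] 𝓢(Rd d, ℂ) :=
  TestFunction.mkCLM ℝ testToSchwartzFun
    (fun f g => by ext x; simp) (fun c f => by ext x; simp)
    (fun K hK => by
      let L : 𝓓_{K}(Rd d, ℝ) →ₗ[ℝ] 𝓢(Rd d, ℂ) :=
        { toFun := fun f => testToSchwartzFun (TestFunction.ofSupportedIn hK f)
          map_add' := fun f g => by ext x; simp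
          map_smul' := fun c f => by ext x; simp }
      change Continuous L
      refine WithSeminorms.continuous_of_isBounded
        (ContDiffMapSupportedIn.withSeminorms ℝ (Rd d) ℝ ⊤ K)
        (schwartz_withSeminorms ℝ (Rd d) ℂ) L fun n => ?_
      obtain ⟨R, hR0, hR⟩ := K.isCompact.isBounded.exists_pos_norm_le
      refine ⟨{n.2}, ⟨R ^ n.1 * ‖Complex.ofRealCLM‖, by positivity⟩, fun f => ?_⟩
      simp only [Finset.sup_singleton]
      refine SchwartzMap.seminorm_le_bound ℝ n.1 n.2 _ (by positivity) fun x => ?_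
      have h1 : (L f : Rd d → ℂ) = Complex.ofRealCLM ∘ (f : Rd d → ℝ) := rfl
      have h2 : ‖iteratedFDeriv ℝ n.2 (L f) x‖ ≤
          ‖Complex.ofRealCLM‖ * ‖iteratedFDeriv ℝ n.2 (f : Rd d → ℝ) x‖ := by
        rw [h1]
        exact ContinuousLinearMap.norm_iteratedFDeriv_comp_left _ f.contDiff.contDiffAt
          (by exact_mod_cast le_top)
      have h3 := ContDiffMapSupportedIn.norm_iteratedFDeriv_apply_le_seminorm_top ℝ
        (i := n.2) (f := f) (x := x)
      by_cases hx : x ∈ K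
      · calc ‖x‖ ^ n.1 * ‖iteratedFDeriv ℝ n.2 (L f) x‖
            ≤ R ^ n.1 * (‖Complex.ofRealCLM‖ * ‖iteratedFDeriv ℝ n.2 (f : Rd d → ℝ) x‖) := by
              gcongr
              exact hR x hx
          _ ≤ R ^ n.1 * (‖Complex.ofRealCLM‖ * ContDiffMapSupportedIn.seminorm ℝ (Rd d) ℝ ⊤ K n.2 f) := by
              gcongr
          _ = _ := by
              rw [← mul_assoc]; rfl
      · have h0 : iteratedFDeriv ℝ n.2 (f : Rd d → ℝ) x = 0 := by
          by_contra hne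
          apply hx
          have := support_iteratedFDeriv_subset (𝕜 := ℝ) n.2 (Function.mem_support.mpr hne)
          exact f.tsupport_subset this
        have h4 : ‖iteratedFDeriv ℝ n.2 (L f) x‖ = 0 := by
          refine le_antisymm (h2.trans ?_) (norm_nonneg _)
          simp [h0]
        rw [h4, mul_zero]
        exact mul_nonneg (mul_nonneg (pow_nonneg hR0.le _) (norm_nonneg _)) (apply_nonneg _ _))

/-- The real part `ℂ^d → ℝ^d`, componentwise. -/
def rePart (d : ℕ) : Cd d →L[ℝ] Rd d where
  toFun z := WithLp.toLp 2 fun i => (z i).re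
  map_add' z w := by ext i; simp
  map_smul' c z := by ext i; simp
  cont := by fun_prop

/-- The `ℝ^d`-valued distribution defined by a real-valued tempered distribution (for a
real-valued `u` and a real test function `φ`, the vector `⟨u, φ⟩ ∈ ℂ^d` is real). -/
def toDistribution (u : 𝓢'(Rd d, Cd d)) : 𝓓'(whole (Rd d), Rd d) :=
  (rePart d) ∘L (ContinuousLinearMap.restrictScalars ℝ (u : 𝓢(Rd d, ℂ) →L[ℂ] Cd d)) ∘L
    (testToSchwartz d)

/-- The restriction `x ↦ φ(t, x)` of a test function on `ℝ × ℝ^d` to a fixed time. -/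
def slice (φ : 𝓓(whole (ℝ × Rd d), ℝ)) (t : ℝ) : 𝓓(whole (Rd d), ℝ) :=
  ⟨fun x => φ (t, x), φ.contDiff.comp (contDiff_const.prodMk contDiff_id),
    φ.hasCompactSupport.comp_isClosedEmbedding
      (Topology.IsClosedEmbedding.of_continuous_injective_isClosedMap (by fun_prop)
        (fun _ _ h => (Prod.ext_iff.mp h).2) (isClosedMap_prodMk_left t)),
    fun _ _ => trivial⟩

/-- The time derivative `∂_t φ` of a test function on `ℝ × ℝ^d`. -/
def timeDeriv (φ : 𝓓(whole (ℝ × Rd d), ℝ)) : 𝓓(whole (ℝ × Rd d), ℝ) := ∂_{((1 : ℝ), (0 : Rd d))} φ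

theorem timeDeriv_apply (φ : 𝓓(whole (ℝ × Rd d), ℝ)) (t : ℝ) (x : Rd d) :
    timeDeriv φ (t, x) = deriv (fun τ => φ (τ, x)) t := by
  have h : timeDeriv φ (t, x) = lineDeriv ℝ φ (t, x) ((1 : ℝ), (0 : Rd d)) :=
    TestFunction.lineDerivCLM_apply_of_le (𝕜 := ℝ) le_top
  rw [h, lineDeriv]
  simp only [Prod.smul_mk, Prod.mk_add_mk, smul_zero, add_zero, smul_eq_mul, mul_one]
  rw [deriv_comp_const_add (fun τ => φ (τ, x)) t 0, add_zero]

/-- The curve `u : [0,∞) → H^s` defines the distribution `U` on `ℝ × ℝ^d`, that is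
`⟨U, φ⟩ = ∫_0^∞ ⟨u(t), φ(t,·)⟩ dt` for every test function `φ`. -/
def InducesDistribution (u : ℝ → Hs d s) (U : 𝓓'(whole (ℝ × Rd d), Rd d)) : Prop :=
  ∀ φ : 𝓓(whole (ℝ × Rd d), ℝ),
    IntegrableOn (fun t => toDistribution (u t).toTempered (slice φ t)) (Ioi 0) ∧
      U φ = ∫ t in Ioi (0 : ℝ), toDistribution (u t).toTempered (slice φ t)

/-! ### The peridynamics model -/

/-- The cut-off functions `χ ∈ L^∞(ℝ)` of the model, with `supp χ ⊆ [-1,1]`, `0 ≤ χ ≤ 1`, and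
`χ = 1` on `[-1/2,1/2]`. -/
structure IsCutoff (χ : ℝ → ℝ) : Prop where
  aemeasurable : AEMeasurable χ volume
  eq_zero : ∀ᵐ r, r ∉ Icc (-1 : ℝ) 1 → χ r = 0
  mem_Icc : ∀ᵐ r, χ r ∈ Icc (0 : ℝ) 1
  eq_one : ∀ᵐ r, r ∈ Icc (-(1 / 2) : ℝ) (1 / 2) → χ r = 1

/-- The kernel `κ δ^{-2(1-α)} χ(|y|/δ) |y|^{-(d+2α)}`. -/
def kernel (κ α δ : ℝ) (χ : ℝ → ℝ) (y : Rd d) : ℝ :=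
  κ / δ ^ (2 * (1 - α)) * (χ (‖y‖ / δ) / ‖y‖ ^ ((d : ℝ) + 2 * α))

/-- The value at `x` of the dual peridynamics operator applied to `v` exists and equals `k`, that is
`k = - κ δ^{-2(1-α)} p.v.∫ χ(|y|/δ) (v(x) - v(x+y)) / |y|^{d+2α} dy`. -/
def HasDualValue (κ α δ : ℝ) (χ : ℝ → ℝ) (v : Rd d → ℝ) (x : Rd d) (k : ℝ) : Prop :=
  Tendsto (fun ε : ℝ => -∫ y in (Metric.ball (0 : Rd d) ε)ᶜ,
    kernel κ α δ χ y * (v x - v (x + y))) (𝓝[>] 0) (𝓝 k)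

/-- The dispersion relation
`ω(ξ) = (κ δ^{-2(1-α)} ∫ χ(|y|/δ) (1 - cos(y·ξ)) / |y|^{d+2α} dy)^{1/2}`. -/
def dispersion (κ α δ : ℝ) (χ : ℝ → ℝ) (ξ : Rd d) : ℝ :=
  √(∫ y : Rd d, kernel κ α δ χ y * (1 - Real.cos (inner ℝ y ξ)))

/-- The multiplier `sin(ω t) / ω`, with its limit value `t` at `ω = 0`. -/
def sinDiv (ω t : ℝ) : ℝ := if ω = 0 then t else Real.sin (ω * t) / ω

/-- `U` is a distributional solution of `∂_tt u - K_δ[u] = 0` with initial data `(u₀, v₀)`: it is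
supported in `[0,∞) × ℝ^d`, and for every test function `φ` the function `ψ = ∂_tt φ - K_δ^*[φ]`
is again a test function, with `⟨U, ψ⟩ = -⟨u₀, ∂_t φ(0,·)⟩ + ⟨v₀, φ(0,·)⟩`. As `K_δ^*` acts
componentwise, the vector-valued distributions are tested against scalar test functions. -/
def IsDistributionalSolution (κ α δ : ℝ) (χ : ℝ → ℝ) (u₀ v₀ : 𝓓'(whole (Rd d), Rd d))
    (U : 𝓓'(whole (ℝ × Rd d), Rd d)) : Prop :=
  Distribution.dsupport U ⊆ Ici (0 : ℝ) ×ˢ (univ : Set (Rd d)) ∧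
  ∀ φ : 𝓓(whole (ℝ × Rd d), ℝ), ∃ ψ : 𝓓(whole (ℝ × Rd d), ℝ),
    (∀ t x, HasDualValue κ α δ χ (slice φ t) x (timeDeriv (timeDeriv φ) (t, x) - ψ (t, x))) ∧
      U ψ = -u₀ (slice (timeDeriv φ) 0) + v₀ (slice φ 0)

end Peridynamics

end

noncomputable section

namespace Peridynamics

/-! The operator `K_δ` is the Fourier multiplier with symbol `-ω_δ²`, so at each frequency the
equation is the harmonic oscillator `û'' + ω² û = 0`, and the stated formula is its solution. What
has to be proved is that this formula defines a curve with the claimed regularity and that it can be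
tested against functions on `ℝ × ℝ^d`.

Regularity rests on the fact that `ω_δ` has order `α`. Scaling gives `ω² ≤ C|ξ|^{2α}`
(`exists_symbol_kernel_le`), and the singularity of the kernel at the origin gives `ω² ≥ c|ξ|^{2α}`
at high frequency (`exists_le_symbol_kernel`). The lower bound lets `sin(ωt)/ω` recover the `α`
derivatives by which `v₀` is worse than `u₀`; the upper bound makes `∂_t cos(ωt) = -ω sin(ωt)` cost
only `α` derivatives. Through the isometry `Hs.profile` onto weighted Fourier transforms, continuity
and differentiability in time reduce to dominated convergence for multipliers in `L²`
(`tendsto_multiply`, `hasDerivAt_multiply`). Evenness of `ω` preserves Hermitian symmetry, hence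
real-valuedness.

For the weak formulation, evenness of the kernel turns the principal value into an absolutely
convergent integral of second differences (`IsEvenKernel.tendsto_nonlocalOp`). In this form the dual
operator commutes with derivatives and enlarges supports boundedly, so it preserves test functions,
and its symbol is computed by Fubini (`IsEvenKernel.sliceFourier_nonlocalOp`). Rapid decay of the
Fourier transforms of time slices (`exists_sliceFourier_le`) makes the space-time pairing converge
absolutely and depend continuously on the test function. After exchanging the integrals, two
integrations by parts in time at each frequency leave exactly the initial data
(`integral_sliceFourier_smul_waveFourier`).

The computations use the frequency variable of `𝓕`, where the dispersion relation is `W(ξ) =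
ω(2πξ)`; the angular normalization enters only in the final formula. -/

/-- Even nonnegative kernels supported in the ball of radius `r`, with finite second moment. -/
structure IsEvenKernel {d : ℕ} (k : Rd d → ℝ) (r : ℝ) : Prop where
  aestronglyMeasurable : AEStronglyMeasurable k volume
  neg_apply : ∀ y, k (-y) = k y
  nonneg : ∀ᵐ y, 0 ≤ k y
  eq_zero : ∀ᵐ y, r < ‖y‖ → k y = 0
  integrable : Integrable (fun y => ‖y‖ ^ 2 * k y)

/-- The second difference of `φ` at `p` in the spatial direction `y`. -/
def secondDiff {d : ℕ} {F : Type} [NormedAddCommGroup F] [NormedSpace ℝ F] (φ : ℝ × Rd d → F)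
    (p : ℝ × Rd d) (y : Rd d) : F :=
  φ (p + (0, y)) + φ (p - (0, y)) - (2 : ℝ) • φ p

/-- The nonlocal operator `½ ∫ k(y) (φ(t, x + y) + φ(t, x - y) - 2 φ(t, x)) dy`. -/
def nonlocalOp {d : ℕ} {F : Type} [NormedAddCommGroup F] [NormedSpace ℝ F] (k : Rd d → ℝ)
    (φ : ℝ × Rd d → F) (p : ℝ × Rd d) : F :=
  (1 / 2 : ℝ) • ∫ y, k y • secondDiff φ p y

/-! ### The nonlocal operator on smooth compactly supported functions. -/

section NonlocalOperator

variable {d : ℕ} {k : Rd d → ℝ} {r : ℝ} {F : Type} [NormedAddCommGroup F] [NormedSpace ℝ F]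
  {φ : ℝ × Rd d → F}

/-- As a function of the increment `v`, the second difference has derivative `φ'(p + v) - φ'(p -
v)`, of size at most `2L‖v‖` with `L` a Lipschitz constant of `φ'`. The mean value inequality on the
ball of radius `‖y‖` supplies the second factor `‖y‖`, so that a finite second moment of the kernel
suffices for integrability. -/
theorem exists_norm_secondDiff_le (hφ : ContDiff ℝ 2 φ) (hc : HasCompactSupport φ) :
    ∃ C, 0 ≤ C ∧ ∀ p y, ‖secondDiff φ p y‖ ≤ C * ‖y‖ ^ 2 := by
  obtain ⟨C, hC⟩ := (hc.fderiv ℝ).exists_bound_of_continuous (f := fderiv ℝ φ)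
    (hφ.continuous_fderiv (by norm_num)) |>.imp fun _ h => h
  obtain ⟨L, hL⟩ := ContDiff.lipschitzWith_of_hasCompactSupport (𝕂 := ℝ) (n := 1)
    (hc.fderiv ℝ) (hφ.fderiv_right (by norm_num)) (by norm_num)
  refine ⟨2 * L, by positivity, fun p y => ?_⟩
  have hd : Differentiable ℝ φ := hφ.differentiable (by norm_num)
  have key := Convex.norm_image_sub_le_of_norm_hasFDerivWithin_le (𝕜 := ℝ)
    (f := fun v : ℝ × Rd d => φ (p + v) + φ (p - v) - (2 : ℝ) • φ p)
    (f' := fun v => fderiv ℝ φ (p + v) - fderiv ℝ φ (p - v)) (C := 2 * L * ‖y‖)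
    (s := Metric.closedBall 0 ‖y‖) (x := 0) (y := (0, y)) ?_ ?_
    (convex_closedBall _ _) (by simp) (by simp [Prod.norm_def])
  · have h0 : φ (p + 0) + φ (p - 0) - (2 : ℝ) • φ p = 0 := by
      rw [add_zero, sub_zero, two_smul, sub_self]
    rw [h0, sub_zero, sub_zero] at key
    calc ‖secondDiff φ p y‖ ≤ _ := key
      _ = _ := by
        have : ‖((0 : ℝ), y)‖ = ‖y‖ := by simp [Prod.norm_def]
        rw [this]; ring
  · intro v _
    have h1 : HasFDerivAt (fun v : ℝ × Rd d => φ (p + v)) (fderiv ℝ φ (p + v)) v := by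
      have := (hd (p + v)).hasFDerivAt.comp v ((hasFDerivAt_id v).const_add p)
      simpa [Function.comp_def] using this
    have h2 : HasFDerivAt (fun v : ℝ × Rd d => φ (p - v)) (-fderiv ℝ φ (p - v)) v := by
      have := (hd (p - v)).hasFDerivAt.comp v ((hasFDerivAt_id v).const_sub p)
      simpa [Function.comp_def] using this
    have := ((h1.add h2).sub_const ((2 : ℝ) • φ p)).hasFDerivWithinAt
      (s := Metric.closedBall 0 ‖y‖)
    rwa [← sub_eq_add_neg] at this
  · intro v hv
    rw [mem_closedBall_zero_iff] at hv
    calc ‖fderiv ℝ φ (p + v) - fderiv ℝ φ (p - v)‖ ≤ L * ‖(p + v) - (p - v)‖ :=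
          hL.norm_sub_le _ _
      _ = L * ‖(2 : ℝ) • v‖ := by congr 2; rw [two_smul]; abel
      _ ≤ 2 * L * ‖y‖ := by
        rw [norm_smul, Real.norm_ofNat]
        have : (0 : ℝ) ≤ L := L.2
        nlinarith

theorem continuous_secondDiff (hφ : Continuous φ) :
    Continuous fun q : (ℝ × Rd d) × Rd d => secondDiff φ q.1 q.2 := by
  unfold secondDiff
  fun_prop

theorem IsEvenKernel.norm_smul_secondDiff_le (hk : IsEvenKernel k r) {C : ℝ}
    (hC : ∀ p y, ‖secondDiff φ p y‖ ≤ C * ‖y‖ ^ 2) :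
    ∀ᵐ y, ∀ p, ‖k y • secondDiff φ p y‖ ≤ C * (‖y‖ ^ 2 * k y) := by
  filter_upwards [hk.nonneg] with y hy p
  rw [norm_smul, Real.norm_of_nonneg hy]
  nlinarith [hC p y]

theorem IsEvenKernel.aestronglyMeasurable_smul_secondDiff (hk : IsEvenKernel k r)
    (hφ : Continuous φ) (p : ℝ × Rd d) :
    AEStronglyMeasurable (fun y => k y • secondDiff φ p y) volume :=
  hk.aestronglyMeasurable.smul
    ((continuous_secondDiff hφ).comp (Continuous.prodMk_right p)).aestronglyMeasurable

theorem IsEvenKernel.integrable_smul_secondDiff (hk : IsEvenKernel k r)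
    (hφ : ContDiff ℝ 2 φ) (hc : HasCompactSupport φ) (p : ℝ × Rd d) :
    Integrable fun y => k y • secondDiff φ p y := by
  obtain ⟨C, -, hC⟩ := exists_norm_secondDiff_le hφ hc
  refine (hk.integrable.const_mul C).mono'
    (hk.aestronglyMeasurable_smul_secondDiff hφ.continuous p) ?_
  filter_upwards [hk.norm_smul_secondDiff_le hC] with y hy using hy p

/-- The operator commutes with differentiation. Three derivatives of `φ` make `fderiv ℝ φ` of class
`C²`, and its quadratic bound dominates the differentiated integrand uniformly in the base point. -/
theorem IsEvenKernel.hasFDerivAt_nonlocalOp (hk : IsEvenKernel k r)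
    (hφ : ContDiff ℝ 3 φ) (hc : HasCompactSupport φ) (p : ℝ × Rd d) :
    HasFDerivAt (nonlocalOp k φ) (nonlocalOp k (fderiv ℝ φ) p) p := by
  obtain ⟨C, -, hC⟩ := exists_norm_secondDiff_le (φ := fderiv ℝ φ)
    (hφ.fderiv_right (by norm_num)) (hc.fderiv ℝ)
  have hd : Differentiable ℝ φ := hφ.differentiable (by norm_num)
  refine HasFDerivAt.const_smul (hasFDerivAt_integral_of_dominated_of_fderiv_le
    (F := fun p y => k y • secondDiff φ p y)
    (F' := fun p y => k y • secondDiff (fderiv ℝ φ) p y) (s := univ) univ_mem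
    (Eventually.of_forall fun q => hk.aestronglyMeasurable_smul_secondDiff hφ.continuous q)
    (hk.integrable_smul_secondDiff (hφ.of_le (by norm_num)) hc p)
    (hk.aestronglyMeasurable_smul_secondDiff (hφ.continuous_fderiv (by norm_num)) p)
    ?_ (hk.integrable.const_mul C) ?_) _
  · filter_upwards [hk.norm_smul_secondDiff_le hC] with y hy q _ using hy q
  · refine Eventually.of_forall fun y q _ => HasFDerivAt.const_smul ?_ (k y)
    have h1 : HasFDerivAt (fun q => φ (q + (0, y))) (fderiv ℝ φ (q + (0, y))) q := by
      have := (hd (q + (0, y))).hasFDerivAt.comp q ((hasFDerivAt_id q).add_const (0, y))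
      simpa [Function.comp_def] using this
    have h2 : HasFDerivAt (fun q => φ (q - (0, y))) (fderiv ℝ φ (q - (0, y))) q := by
      have := (hd (q - (0, y))).hasFDerivAt.comp q ((hasFDerivAt_id q).sub_const (0, y))
      simpa [Function.comp_def] using this
    exact (h1.add h2).sub ((hd q).hasFDerivAt.const_smul (2 : ℝ))

/-- The target space is quantified inside the induction because the derivative is the same operator
applied to `fderiv ℝ φ`, which takes values in another space. -/
theorem IsEvenKernel.contDiff_nat_nonlocalOp (hk : IsEvenKernel k r) (n : ℕ) :
    ∀ (F : Type) [NormedAddCommGroup F] [NormedSpace ℝ F] (φ : ℝ × Rd d → F),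
      ContDiff ℝ ((⊤ : ℕ∞) : WithTop ℕ∞) φ → HasCompactSupport φ →
        ContDiff ℝ n (nonlocalOp k φ) := by
  induction n with
  | zero =>
    intro F _ _ φ hφ hc
    refine contDiff_zero.mpr (continuous_iff_continuousAt.mpr fun p => ?_)
    exact (hk.hasFDerivAt_nonlocalOp
      (by exact_mod_cast contDiff_infty.mp hφ 3) hc p).continuousAt
  | succ n ih =>
    intro F _ _ φ hφ hc
    refine contDiff_succ_iff_hasFDerivAt.mpr ⟨nonlocalOp k (fderiv ℝ φ),
      ih _ _ (hφ.fderiv_right (by simp)) (hc.fderiv ℝ), fun p => ?_⟩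
    exact hk.hasFDerivAt_nonlocalOp
      (by exact_mod_cast contDiff_infty.mp hφ 3) hc p

theorem IsEvenKernel.contDiff_nonlocalOp (hk : IsEvenKernel k r)
    (hφ : ContDiff ℝ ((⊤ : ℕ∞) : WithTop ℕ∞) φ) (hc : HasCompactSupport φ) :
    ContDiff ℝ ((⊤ : ℕ∞) : WithTop ℕ∞) (nonlocalOp k φ) :=
  contDiff_infty.mpr fun n => hk.contDiff_nat_nonlocalOp n F φ hφ hc

/-- Either `‖y‖ > r` and the kernel vanishes, or `p` and `p ± y` all miss the support of `φ`. The
exceptional null set of `y` does not depend on `p`; this is needed when integrating over pairs `(x,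
y)`. -/
theorem IsEvenKernel.smul_secondDiff_eq_zero (hk : IsEvenKernel k r) :
    ∀ᵐ y, ∀ p ∉ Metric.cthickening r (tsupport φ), k y • secondDiff φ p y = 0 := by
  filter_upwards [hk.eq_zero] with y hy p hp
  rcases lt_or_ge r ‖y‖ with h | h
  · rw [hy h, zero_smul]
  · have hmem : ∀ q, dist p q ≤ ‖y‖ → φ q = 0 := fun q hq =>
      image_eq_zero_of_notMem_tsupport fun hmem =>
        hp (Metric.mem_cthickening_of_dist_le p q r _ hmem (hq.trans h))
    have hn : ‖((0 : ℝ), y)‖ = ‖y‖ := by simp [Prod.norm_def]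
    rw [secondDiff, hmem _ (by rw [dist_self_add_right, hn]),
      hmem _ (by rw [dist_self_sub_right, hn]), hmem p (by simp)]
    simp

theorem IsEvenKernel.hasCompactSupport_nonlocalOp (hk : IsEvenKernel k r)
    (hc : HasCompactSupport φ) : HasCompactSupport (nonlocalOp k φ) := by
  refine HasCompactSupport.intro (K := Metric.cthickening r (tsupport φ)) hc.isCompact.cthickening
    fun p hp => ?_
  rw [nonlocalOp, integral_eq_zero_of_ae, smul_zero]
  filter_upwards [hk.smul_secondDiff_eq_zero (φ := φ)] with y hy using hy p hp

theorem IsEvenKernel.integrableOn_compl_ball (hk : IsEvenKernel k r) {ε : ℝ} (hε : 0 < ε) :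
    IntegrableOn k (Metric.ball (0 : Rd d) ε)ᶜ := by
  refine (hk.integrable.integrableOn.const_mul (ε ^ 2)⁻¹).mono'
    hk.aestronglyMeasurable.restrict ?_
  filter_upwards [ae_restrict_of_ae hk.nonneg,
    ae_restrict_mem Metric.isOpen_ball.measurableSet.compl] with y hy hmem
  have h : ε ≤ ‖y‖ := by simpa using hmem
  rw [Real.norm_of_nonneg hy, ← div_eq_inv_mul, le_div_iff₀ (by positivity), mul_comm]
  gcongr

/-- The truncated integrals of first differences converge to the nonlocal operator. -/
theorem IsEvenKernel.tendsto_nonlocalOp {φ : ℝ × Rd d → ℝ} (hk : IsEvenKernel k r)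
    (hφ : ContDiff ℝ 2 φ) (hc : HasCompactSupport φ) (t : ℝ) (x : Rd d) :
    Tendsto (fun ε : ℝ => -∫ y in (Metric.ball (0 : Rd d) ε)ᶜ, k y * (φ (t, x) - φ (t, x + y)))
      (𝓝[>] 0) (𝓝 (nonlocalOp k φ (t, x))) := by
  obtain ⟨B, hB⟩ := hφ.continuous.bounded_above_of_compact_support hc
  have hfirst : ∀ ε > 0, ∀ g : Rd d → Rd d, Continuous g → IntegrableOn
      (fun y => k y * (φ (t, x) - φ (t, x + g y))) (Metric.ball (0 : Rd d) ε)ᶜ := by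
    intro ε hε g hg
    refine (hk.integrableOn_compl_ball hε).mul_bdd (c := B + B) ?_ ?_
    · have := hφ.continuous
      exact Continuous.aestronglyMeasurable (by fun_prop)
    · exact Eventually.of_forall fun y => (norm_sub_le _ _).trans (add_le_add (hB _) (hB _))
  -- Away from the origin the first differences are integrable against the kernel, so the integral
  -- may be averaged with its image under `y ↦ -y`. Only the averaged form has an integrable limit
  -- as `ε → 0`.
  have hsymm : ∀ ε > 0, -∫ y in (Metric.ball (0 : Rd d) ε)ᶜ, k y * (φ (t, x) - φ (t, x + y)) =
      (1 / 2 : ℝ) • ∫ y, (Metric.ball (0 : Rd d) ε)ᶜ.indicator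
        (fun y => k y • secondDiff φ (t, x) y) y := by
    intro ε hε
    have hneg : ∫ y in (Metric.ball (0 : Rd d) ε)ᶜ, k y * (φ (t, x) - φ (t, x + y)) =
        ∫ y in (Metric.ball (0 : Rd d) ε)ᶜ, k y * (φ (t, x) - φ (t, x + -y)) := by
      rw [← integral_indicator Metric.isOpen_ball.measurableSet.compl,
        ← integral_indicator Metric.isOpen_ball.measurableSet.compl,
        ← integral_neg_eq_self]
      congr 1 with y
      simp only [indicator, mem_compl_iff, mem_ball_zero_iff, norm_neg, hk.neg_apply]
    have hsum : ∫ y in (Metric.ball (0 : Rd d) ε)ᶜ, k y • secondDiff φ (t, x) y =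
        -((∫ y in (Metric.ball (0 : Rd d) ε)ᶜ, k y * (φ (t, x) - φ (t, x + y))) +
          ∫ y in (Metric.ball (0 : Rd d) ε)ᶜ, k y * (φ (t, x) - φ (t, x + -y))) := by
      rw [← integral_add (hfirst ε hε (fun y => y) continuous_id) (hfirst ε hε _ continuous_neg),
        ← integral_neg]
      congr 1 with y
      simp only [secondDiff, smul_eq_mul, Prod.mk_add_mk, add_zero,
        sub_eq_add_neg, neg_zero, Prod.neg_mk]
      ring
    rw [integral_indicator Metric.isOpen_ball.measurableSet.compl, hsum, ← hneg, smul_eq_mul]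
    ring
  refine Tendsto.congr' (f₁ := fun ε : ℝ => (1 / 2 : ℝ) • ∫ y,
    (Metric.ball (0 : Rd d) ε)ᶜ.indicator (fun y => k y • secondDiff φ (t, x) y) y) ?_ ?_
  · filter_upwards [self_mem_nhdsWithin] with ε hε using (hsymm ε hε).symm
  refine Tendsto.const_smul ?_ (1 / 2 : ℝ)
  have hint := hk.integrable_smul_secondDiff hφ hc (t, x)
  refine tendsto_integral_filter_of_dominated_convergence
    (fun y => ‖k y • secondDiff φ (t, x) y‖) ?_ ?_ hint.norm ?_
  · exact Eventually.of_forall fun ε =>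
      hint.aestronglyMeasurable.indicator Metric.isOpen_ball.measurableSet.compl
  · exact Eventually.of_forall fun ε => Eventually.of_forall fun y =>
      norm_indicator_le_norm_self _ _
  · refine Eventually.of_forall fun y => ?_
    refine tendsto_const_nhds.congr' ?_
    -- The origin is removed by every truncation, but the second difference vanishes there; any
    -- other `y` is kept once `ε < ‖y‖`.
    rcases eq_or_ne y 0 with rfl | hy
    · refine Eventually.of_forall fun ε => ?_
      have : k 0 • secondDiff φ (t, x) 0 = 0 := by
        simp [secondDiff]; right; ring
      simp only [this]
      exact ((indicator_apply_eq_zero (f := fun y => k y • secondDiff φ (t, x) y)).mpr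
        fun _ => this).symm
    · have : Iio ‖y‖ ∈ 𝓝[>] (0 : ℝ) := mem_nhdsWithin_of_mem_nhds (Iio_mem_nhds (by simpa using hy))
      filter_upwards [this] with ε hε
      rw [indicator_of_mem]
      simpa using hε.le

end NonlocalOperator

/-! ### Radial functions and polar coordinates. -/

theorem nontrivial_Rd {d : ℕ} (hd : 1 ≤ d) : Nontrivial (Rd d) :=
  Module.nontrivial_of_finrank_pos (R := ℝ) (by simpa using (by omega : 0 < d))

/-- The norm on `ℝ^d`, `d ≥ 1`, pulls null sets back to null sets. -/
theorem quasiMeasurePreserving_norm {d : ℕ} (hd : 1 ≤ d) :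
    Measure.QuasiMeasurePreserving (fun y : Rd d => ‖y‖) volume volume := by
  have := nontrivial_Rd hd
  refine ⟨measurable_norm, Measure.AbsolutelyContinuous.mk fun N hN h0 => ?_⟩
  rw [Measure.map_apply measurable_norm hN]
  -- In polar coordinates the measure of the preimage is an integral of `r^{d-1}` over the null set
  -- `N`. Integrability is obtained separately, since a vanishing Bochner integral alone would not
  -- make the indicator vanish almost everywhere.
  have hz : ∀ᵐ r ∂(volume.restrict (Ioi (0 : ℝ))),
      r ^ (Module.finrank ℝ (Rd d) - 1) • N.indicator (fun _ => (1 : ℝ)) r = 0 := by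
    refine ae_restrict_of_ae ?_
    filter_upwards [compl_mem_ae_iff.mpr h0] with r hr
    rw [indicator_of_notMem hr, smul_zero]
  have hint : Integrable (fun y : Rd d => N.indicator (fun _ => (1 : ℝ)) ‖y‖) volume := by
    rw [integrable_fun_norm_addHaar]
    exact (integrable_zero _ _ _).congr (hz.mono fun _ h => h.symm)
  have hzero : ∫ y : Rd d, N.indicator (fun _ => (1 : ℝ)) ‖y‖ = 0 := by
    rw [integral_fun_norm_addHaar, integral_eq_zero_of_ae hz]
    simp
  rw [integral_eq_zero_iff_of_nonneg (fun y => indicator_nonneg (fun _ _ => zero_le_one) _) hint]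
    at hzero
  refine measure_mono_null ?_ (ae_iff.mp hzero)
  intro y hy
  have hy' : ‖y‖ ∈ N := hy
  simp [hy']

/-- The integrand `min(2, ρ²) ρ^{-(d+2α)}` majorizing the dispersion relation at unit frequency. -/
theorem integrable_min_rpow {d : ℕ} (hd : 1 ≤ d) {α : ℝ} (hα₀ : 0 < α) (hα₁ : α < 1) :
    Integrable (fun y : Rd d => min 2 (‖y‖ ^ 2) / ‖y‖ ^ ((d : ℝ) + 2 * α)) := by
  have := nontrivial_Rd hd
  refine (integrable_fun_norm_addHaar volume
    (f := fun r : ℝ => min 2 (r ^ 2) / r ^ ((d : ℝ) + 2 * α))).mpr ?_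
  have hfin : Module.finrank ℝ (Rd d) = d := by simp
  rw [hfin]
  have hmeas : Measurable fun r : ℝ =>
      r ^ (d - 1) • (min 2 (r ^ 2) / r ^ ((d : ℝ) + 2 * α)) := by fun_prop
  have hpow : ∀ r : ℝ, 0 < r → ∀ m : ℝ,
      r ^ (d - 1) * (r ^ m / r ^ ((d : ℝ) + 2 * α)) = r ^ (m - 1 - 2 * α) := by
    intro r hr m
    rw [← Real.rpow_natCast, ← Real.rpow_sub hr, ← Real.rpow_add hr, Nat.cast_sub hd]
    congr 1
    push_cast
    ring
  -- With the Jacobian `r^{d-1}` the integrand is at most `r^{1-2α}` on `(0,1]`, integrable because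
  -- `α < 1`, and at most `2r^{-1-2α}` beyond `1`, integrable because `α > 0`.
  rw [← Ioc_union_Ioi_eq_Ioi zero_le_one]
  refine IntegrableOn.union ?_ ?_
  · have h1 : IntegrableOn (fun r : ℝ => r ^ (1 - 2 * α)) (Ioc 0 1) := by
      have := intervalIntegral.intervalIntegrable_rpow' (a := 0) (b := 1)
        (r := 1 - 2 * α) (by linarith)
      rwa [intervalIntegrable_iff_integrableOn_Ioc_of_le zero_le_one] at this
    refine h1.mono' hmeas.aestronglyMeasurable ?_
    filter_upwards [ae_restrict_mem measurableSet_Ioc] with r hr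
    have hr0 : 0 < r := hr.1
    rw [Real.norm_of_nonneg (by positivity), smul_eq_mul,
      show (1 - 2 * α : ℝ) = 2 - 1 - 2 * α by ring, ← hpow r hr0 2]
    gcongr
    rw [Real.rpow_two]
    exact min_le_right _ _
  · have h1 : IntegrableOn (fun r : ℝ => 2 * r ^ (-1 - 2 * α)) (Ioi 1) :=
      (integrableOn_Ioi_rpow_of_lt (by linarith) one_pos).const_mul 2
    refine h1.mono' hmeas.aestronglyMeasurable ?_
    filter_upwards [ae_restrict_mem measurableSet_Ioi] with r hr
    have hr0 : 0 < r := one_pos.trans hr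
    rw [Real.norm_of_nonneg (by positivity), smul_eq_mul,
      show (-1 - 2 * α : ℝ) = 0 - 1 - 2 * α by ring, ← hpow r hr0 0, Real.rpow_zero]
    calc r ^ (d - 1) * (min 2 (r ^ 2) / r ^ ((d : ℝ) + 2 * α))
        ≤ r ^ (d - 1) * (2 / r ^ ((d : ℝ) + 2 * α)) := by
          gcongr
          exact min_le_left _ _
      _ = _ := by ring

/-! ### The peridynamics kernel. -/

section Kernel

variable {d : ℕ} {κ α δ : ℝ} {χ : ℝ → ℝ}

/-- The constant `κ δ^{-2(1-α)}`. -/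
def amplitude (κ α δ : ℝ) : ℝ := κ / δ ^ (2 * (1 - α))

theorem amplitude_pos (hκ : 0 < κ) (hδ : 0 < δ) : 0 < amplitude κ α δ :=
  div_pos hκ (Real.rpow_pos_of_pos hδ _)

theorem quasiMeasurePreserving_norm_div (hd : 1 ≤ d) (hδ : 0 < δ) :
    Measure.QuasiMeasurePreserving (fun y : Rd d => ‖y‖ / δ) volume volume := by
  have h : Measure.QuasiMeasurePreserving (fun r : ℝ => r / δ) volume volume := by
    refine ⟨by fun_prop, ?_⟩
    simp_rw [div_eq_mul_inv]
    rw [Real.map_volume_mul_right (inv_ne_zero hδ.ne')]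
    exact Measure.smul_absolutelyContinuous
  exact h.comp (quasiMeasurePreserving_norm hd)

theorem kernel_eq (y : Rd d) : kernel κ α δ χ y =
    amplitude κ α δ * (χ (‖y‖ / δ) / ‖y‖ ^ ((d : ℝ) + 2 * α)) := rfl

theorem ae_kernel_nonneg (hd : 1 ≤ d) (hκ : 0 < κ) (hδ : 0 < δ) (hχ : IsCutoff χ) :
    ∀ᵐ y : Rd d, 0 ≤ kernel κ α δ χ y := by
  filter_upwards [(quasiMeasurePreserving_norm_div hd hδ).ae hχ.mem_Icc] with y hy
  have := (amplitude_pos (α := α) hκ hδ).le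
  have := hy.1
  rw [kernel_eq]
  positivity

theorem ae_kernel_le (hd : 1 ≤ d) (hκ : 0 < κ) (hδ : 0 < δ) (hχ : IsCutoff χ) :
    ∀ᵐ y : Rd d, kernel κ α δ χ y ≤ amplitude κ α δ / ‖y‖ ^ ((d : ℝ) + 2 * α) := by
  filter_upwards [(quasiMeasurePreserving_norm_div hd hδ).ae hχ.mem_Icc] with y hy
  have := (amplitude_pos (α := α) hκ hδ).le
  have := hy.2
  rw [kernel_eq, ← mul_one_div (amplitude κ α δ)]
  gcongr

theorem ae_kernel_eq_of_norm_le (hd : 1 ≤ d) (hδ : 0 < δ) (hχ : IsCutoff χ) :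
    ∀ᵐ y : Rd d, ‖y‖ ≤ δ / 2 →
      kernel κ α δ χ y = amplitude κ α δ / ‖y‖ ^ ((d : ℝ) + 2 * α) := by
  filter_upwards [(quasiMeasurePreserving_norm_div hd hδ).ae hχ.eq_one] with y hy h
  rw [kernel_eq, hy, mul_one_div]
  refine ⟨by have : 0 ≤ ‖y‖ / δ := by positivity
             linarith, ?_⟩
  rw [div_le_iff₀ hδ]
  linarith

theorem isEvenKernel_kernel (hd : 1 ≤ d) (hκ : 0 < κ) (hα₀ : 0 < α) (hα₁ : α < 1) (hδ : 0 < δ)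
    (hχ : IsCutoff χ) : IsEvenKernel (kernel (d := d) κ α δ χ) δ := by
  have hA := amplitude_pos (α := α) hκ hδ
  have hmeas : AEStronglyMeasurable (kernel (d := d) κ α δ χ) volume := by
    refine AEMeasurable.aestronglyMeasurable ?_
    have h1 := hχ.aemeasurable.comp_quasiMeasurePreserving (quasiMeasurePreserving_norm_div hd hδ)
    have h2 : Measurable fun y : Rd d => ‖y‖ ^ ((d : ℝ) + 2 * α) := by fun_prop
    exact (h1.div h2.aemeasurable).const_mul (amplitude κ α δ)
  have hzero : ∀ᵐ y : Rd d, δ < ‖y‖ → kernel κ α δ χ y = 0 := by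
    filter_upwards [(quasiMeasurePreserving_norm_div hd hδ).ae hχ.eq_zero] with y hy h
    rw [kernel_eq, hy, zero_div, mul_zero]
    rintro ⟨-, h2⟩
    rw [div_le_one hδ] at h2
    linarith
  refine ⟨hmeas, fun y => by simp [kernel], ae_kernel_nonneg hd hκ hδ hχ, hzero, ?_⟩
  -- The factor `1 + δ²` gives `‖y‖² ≤ (1 + δ²) min(2, ‖y‖²)` on the ball of radius `δ`, outside
  -- which the kernel vanishes.
  refine ((integrable_min_rpow hd hα₀ hα₁).const_mul (amplitude κ α δ * (1 + δ ^ 2))).mono'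
    (AEStronglyMeasurable.mul (by fun_prop) hmeas) ?_
  filter_upwards [hzero, ae_kernel_nonneg (α := α) hd hκ hδ hχ, ae_kernel_le (α := α) hd hκ hδ hχ]
    with y h0 hpos hle
  rw [Real.norm_of_nonneg (by positivity)]
  rcases lt_or_ge δ ‖y‖ with h | h
  · rw [h0 h]
    have : 0 ≤ min 2 (‖y‖ ^ 2) := by positivity
    simp only [mul_zero]
    positivity
  · have hmin : ‖y‖ ^ 2 ≤ (1 + δ ^ 2) * min 2 (‖y‖ ^ 2) := by
      rcases min_cases 2 (‖y‖ ^ 2) with ⟨h2, -⟩ | ⟨h2, -⟩ <;> rw [h2]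
      · nlinarith [norm_nonneg y]
      · nlinarith [sq_nonneg δ, sq_nonneg ‖y‖]
    calc ‖y‖ ^ 2 * kernel κ α δ χ y
        ≤ ((1 + δ ^ 2) * min 2 (‖y‖ ^ 2)) * (amplitude κ α δ / ‖y‖ ^ ((d : ℝ) + 2 * α)) := by
          gcongr
      _ = _ := by ring

end Kernel

/-! ### The symbol of an even kernel. -/

section Symbol

variable {d : ℕ} {k : Rd d → ℝ} {r : ℝ}

theorem one_sub_cos_inner_le (y ξ : Rd d) :
    1 - Real.cos (inner ℝ y ξ) ≤ ‖y‖ ^ 2 * ‖ξ‖ ^ 2 := by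
  have h1 := Real.one_sub_sq_div_two_le_cos (x := inner ℝ y ξ)
  have h2 : (inner ℝ y ξ : ℝ) ^ 2 ≤ (‖y‖ * ‖ξ‖) ^ 2 :=
    sq_le_sq' (by have := abs_real_inner_le_norm y ξ; have := neg_abs_le (inner ℝ y ξ : ℝ); linarith)
      ((le_abs_self _).trans (abs_real_inner_le_norm y ξ))
  nlinarith [sq_nonneg (inner ℝ y ξ : ℝ)]

theorem one_sub_cos_nonneg (x : ℝ) : 0 ≤ 1 - Real.cos x := sub_nonneg.mpr (Real.cos_le_one x)

/-- The symbol `∫ k(y) (1 - cos(y·ξ)) dy` of the nonlocal operator, up to sign. -/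
def symbol (k : Rd d → ℝ) (ξ : Rd d) : ℝ := ∫ y, k y * (1 - Real.cos (inner ℝ y ξ))

/-- An integrable majorant common to all frequencies in a ball, as dominated convergence requires
for continuity of the symbol. -/
theorem IsEvenKernel.norm_mul_one_sub_cos_le (hk : IsEvenKernel k r) (R : ℝ) :
    ∀ᵐ y, ∀ ξ : Rd d, ‖ξ‖ ≤ R →
      ‖k y * (1 - Real.cos (inner ℝ y ξ))‖ ≤ R ^ 2 * (‖y‖ ^ 2 * k y) := by
  filter_upwards [hk.nonneg] with y hy ξ hξ
  rw [norm_mul, Real.norm_of_nonneg hy, Real.norm_of_nonneg (one_sub_cos_nonneg _)]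
  have h1 := one_sub_cos_inner_le y ξ
  have h2 : ‖y‖ ^ 2 * ‖ξ‖ ^ 2 ≤ ‖y‖ ^ 2 * R ^ 2 := by gcongr
  calc k y * (1 - Real.cos (inner ℝ y ξ)) ≤ k y * (‖y‖ ^ 2 * R ^ 2) := by
        gcongr; exact h1.trans h2
    _ = _ := by ring

theorem IsEvenKernel.aestronglyMeasurable_mul_one_sub_cos (hk : IsEvenKernel k r) (ξ : Rd d) :
    AEStronglyMeasurable (fun y => k y * (1 - Real.cos (inner ℝ y ξ))) volume :=
  hk.aestronglyMeasurable.mul (Continuous.aestronglyMeasurable (by fun_prop))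

theorem IsEvenKernel.integrable_mul_one_sub_cos (hk : IsEvenKernel k r) (ξ : Rd d) :
    Integrable fun y => k y * (1 - Real.cos (inner ℝ y ξ)) := by
  refine (hk.integrable.const_mul (‖ξ‖ ^ 2)).mono' (hk.aestronglyMeasurable_mul_one_sub_cos ξ) ?_
  filter_upwards [hk.norm_mul_one_sub_cos_le ‖ξ‖] with y hy using hy ξ le_rfl

theorem IsEvenKernel.continuous_symbol (hk : IsEvenKernel k r) : Continuous (symbol k) := by
  refine continuous_iff_continuousAt.mpr fun ξ₀ => ?_
  refine continuousAt_of_dominated (bound := fun y => (‖ξ₀‖ + 1) ^ 2 * (‖y‖ ^ 2 * k y))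
    (Eventually.of_forall fun ξ => hk.aestronglyMeasurable_mul_one_sub_cos ξ) ?_
    (hk.integrable.const_mul _) ?_
  · filter_upwards [Metric.ball_mem_nhds ξ₀ one_pos] with ξ hξ
    filter_upwards [hk.norm_mul_one_sub_cos_le (‖ξ₀‖ + 1)] with y hy
    refine hy ξ ?_
    have : ‖ξ - ξ₀‖ < 1 := by simpa [dist_eq_norm] using hξ
    linarith [norm_le_norm_add_norm_sub' ξ ξ₀]
  · exact Eventually.of_forall fun y => by fun_prop

theorem IsEvenKernel.symbol_nonneg (hk : IsEvenKernel k r) (ξ : Rd d) : 0 ≤ symbol k ξ := by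
  refine integral_nonneg_of_ae ?_
  filter_upwards [hk.nonneg] with y hy using mul_nonneg hy (one_sub_cos_nonneg _)

theorem symbol_neg (k : Rd d → ℝ) (ξ : Rd d) : symbol k (-ξ) = symbol k ξ := by
  simp [symbol]

end Symbol

/-! ### Two-sided bounds of order `2α` for the symbol. -/

section Dispersion

variable {d : ℕ} {κ α δ : ℝ} {χ : ℝ → ℝ}

theorem dispersion_eq_sqrt_symbol (ξ : Rd d) :
    dispersion κ α δ χ ξ = √(symbol (kernel κ α δ χ) ξ) := rfl

/-- Since `χ ≤ 1` and `1 - cos(y·ξ) ≤ min(2, ‖y‖²‖ξ‖²)`, the symbol is dominated by an integral that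
is homogeneous in `ξ`: the substitution `y ↦ y/‖ξ‖` extracts `‖ξ‖^{2α}` and leaves a finite
constant. -/
theorem exists_symbol_kernel_le (hd : 1 ≤ d) (hκ : 0 < κ) (hα₀ : 0 < α) (hα₁ : α < 1) (hδ : 0 < δ)
    (hχ : IsCutoff χ) :
    ∃ C, 0 ≤ C ∧ ∀ ξ : Rd d, symbol (kernel κ α δ χ) ξ ≤ C * ‖ξ‖ ^ (2 * α) := by
  have hA := amplitude_pos (α := α) hκ hδ
  set g : Rd d → ℝ := fun y => min 2 (‖y‖ ^ 2) / ‖y‖ ^ ((d : ℝ) + 2 * α) with hg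
  have hgi : Integrable g := integrable_min_rpow hd hα₀ hα₁
  have hg0 : ∀ y, 0 ≤ g y := fun y => by
    have : 0 ≤ min 2 (‖y‖ ^ 2) := by positivity
    simp only [hg]
    positivity
  refine ⟨amplitude κ α δ * ∫ y, g y, mul_nonneg hA.le (integral_nonneg (f := g) hg0), fun ξ => ?_⟩
  rcases eq_or_ne ξ 0 with rfl | hξ
  · have : symbol (kernel (d := d) κ α δ χ) 0 = 0 := by simp [symbol]
    rw [this]
    have := integral_nonneg (μ := volume) (f := g) hg0
    positivity
  have hξ0 : 0 < ‖ξ‖ := norm_pos_iff.mpr hξ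
  have hscale : ∀ y : Rd d, ‖ξ‖ ^ ((d : ℝ) + 2 * α) * g (‖ξ‖ • y) =
      min 2 (‖y‖ ^ 2 * ‖ξ‖ ^ 2) / ‖y‖ ^ ((d : ℝ) + 2 * α) := by
    intro y
    simp only [hg, norm_smul, norm_norm]
    rw [Real.mul_rpow (norm_nonneg _) (norm_nonneg _), mul_pow, mul_comm (‖ξ‖ ^ 2)]
    have : ‖ξ‖ ^ ((d : ℝ) + 2 * α) ≠ 0 := (Real.rpow_pos_of_pos hξ0 _).ne'
    rw [← mul_div_assoc, mul_div_mul_left _ _ this]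
  have hgs : Integrable fun y : Rd d =>
      amplitude κ α δ * (‖ξ‖ ^ ((d : ℝ) + 2 * α) * g (‖ξ‖ • y)) :=
    ((hgi.comp_smul hξ0.ne').const_mul _).const_mul _
  have hle : symbol (kernel κ α δ χ) ξ ≤
      ∫ y, amplitude κ α δ * (‖ξ‖ ^ ((d : ℝ) + 2 * α) * g (‖ξ‖ • y)) := by
    refine integral_mono_ae
      ((isEvenKernel_kernel hd hκ hα₀ hα₁ hδ hχ).integrable_mul_one_sub_cos ξ) hgs ?_
    filter_upwards [ae_kernel_nonneg hd hκ hδ hχ, ae_kernel_le hd hκ hδ hχ] with y h1 h2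
    rw [hscale]
    calc kernel κ α δ χ y * (1 - Real.cos (inner ℝ y ξ))
        ≤ (amplitude κ α δ / ‖y‖ ^ ((d : ℝ) + 2 * α)) * min 2 (‖y‖ ^ 2 * ‖ξ‖ ^ 2) := by
          gcongr
          · exact one_sub_cos_nonneg _
          · exact le_min (by linarith [Real.neg_one_le_cos (inner ℝ y ξ)])
              (one_sub_cos_inner_le y ξ)
      _ = _ := by ring
  refine hle.trans_eq ?_
  rw [integral_const_mul, integral_const_mul, Measure.integral_comp_smul,
    abs_of_nonneg (by positivity), smul_eq_mul]
  have hfin : Module.finrank ℝ (Rd d) = d := by simp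
  rw [hfin, Real.rpow_add hξ0, Real.rpow_natCast]
  field_simp

/-- One ball suffices. Around `y₀ = ξ/‖ξ‖²`, where `y₀·ξ = 1`, the ball of radius `1/(2‖ξ‖)` keeps
the phase in `[1/2, 3/2]`, so `1 - cos` is bounded below. There the kernel is at least a multiple of
`‖ξ‖^{d+2α}`, while the volume is a multiple of `‖ξ‖^{-d}`. The condition `‖ξ‖ ≥ 3/δ` gives `‖y‖ ≤
3/(2‖ξ‖) ≤ δ/2`, where the cut-off equals one. -/
theorem exists_le_symbol_kernel (hd : 1 ≤ d) (hκ : 0 < κ) (hα₀ : 0 < α) (hα₁ : α < 1) (hδ : 0 < δ)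
    (hχ : IsCutoff χ) :
    ∃ c, 0 < c ∧ ∀ ξ : Rd d, 3 / δ ≤ ‖ξ‖ → c * ‖ξ‖ ^ (2 * α) ≤ symbol (kernel κ α δ χ) ξ := by
  have hA := amplitude_pos (α := α) hκ hδ
  have hk := isEvenKernel_kernel (d := d) hd hκ hα₀ hα₁ hδ hχ
  have := nontrivial_Rd hd
  set m : ℝ := volume.real (Metric.ball (0 : Rd d) (1 / 2)) with hm
  have hm0 : 0 < m := ENNReal.toReal_pos
    (Metric.measure_ball_pos _ _ (by norm_num)).ne' measure_ball_lt_top.ne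
  set c₀ : ℝ := amplitude κ α δ * (2 / Real.pi ^ 2 * (1 / 2) ^ 2) / (3 / 2) ^ ((d : ℝ) + 2 * α)
    with hc₀
  refine ⟨c₀ * m, by positivity, fun ξ hξ => ?_⟩
  have hξ0 : 0 < ‖ξ‖ := lt_of_lt_of_le (by positivity) hξ
  set y₀ : Rd d := (‖ξ‖ ^ 2)⁻¹ • ξ with hy₀
  set B : Set (Rd d) := Metric.ball y₀ (‖ξ‖⁻¹ * (1 / 2)) with hB
  have hvol : volume.real B = (‖ξ‖ ^ d)⁻¹ * m := by
    rw [hB, measureReal_def, Measure.addHaar_ball_mul_of_pos volume _ (by positivity),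
      ENNReal.toReal_mul, ENNReal.toReal_ofReal (by positivity), hm, measureReal_def]
    simp
  have hmain : ∀ᵐ y : Rd d, y ∈ B → c₀ * ‖ξ‖ ^ ((d : ℝ) + 2 * α) ≤
      kernel κ α δ χ y * (1 - Real.cos (inner ℝ y ξ)) := by
    filter_upwards [ae_kernel_eq_of_norm_le (κ := κ) (α := α) hd hδ hχ] with y hy hyB
    have hdist : ‖y - y₀‖ < ‖ξ‖⁻¹ * (1 / 2) := by simpa [hB, dist_eq_norm] using hyB
    have hny₀ : ‖y₀‖ = ‖ξ‖⁻¹ := by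
      rw [hy₀, norm_smul, norm_inv, norm_pow, norm_norm]
      field_simp
    have hny : ‖y‖ ≤ 3 / 2 * ‖ξ‖⁻¹ := by linarith [norm_le_norm_add_norm_sub' y y₀]
    have hny' : 0 < ‖y‖ := by
      have := norm_le_norm_add_norm_sub y y₀
      have : 0 < ‖ξ‖⁻¹ := by positivity
      linarith
    have hinner : |inner ℝ y ξ - 1| ≤ 1 / 2 := by
      have h1 : (inner ℝ y₀ ξ : ℝ) = 1 := by
        rw [hy₀, real_inner_smul_left, real_inner_self_eq_norm_sq]
        field_simp
      calc |(inner ℝ y ξ : ℝ) - 1| = |inner ℝ (y - y₀) ξ| := by rw [inner_sub_left, h1]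
        _ ≤ ‖y - y₀‖ * ‖ξ‖ := abs_real_inner_le_norm _ _
        _ ≤ (‖ξ‖⁻¹ * (1 / 2)) * ‖ξ‖ := by gcongr
        _ = 1 / 2 := by field_simp
    obtain ⟨hi1, hi2⟩ := abs_le.mp hinner
    have hcos : 2 / Real.pi ^ 2 * (1 / 2) ^ 2 ≤ 1 - Real.cos (inner ℝ y ξ) := by
      have h2 := Real.cos_le_one_sub_mul_cos_sq (x := inner ℝ y ξ)
        (by rw [abs_le]; constructor <;> linarith [Real.pi_gt_three])
      have h3 : (1 / 2 : ℝ) ^ 2 ≤ (inner ℝ y ξ : ℝ) ^ 2 := by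
        gcongr; linarith
      have h4 : 2 / Real.pi ^ 2 * (1 / 2) ^ 2 ≤ 2 / Real.pi ^ 2 * (inner ℝ y ξ : ℝ) ^ 2 := by
        gcongr
      linarith
    have hsmall : ‖y‖ ≤ δ / 2 := by
      refine hny.trans ?_
      have : ‖ξ‖⁻¹ ≤ (3 / δ)⁻¹ := inv_anti₀ (by positivity) hξ
      rw [inv_div] at this
      linarith
    rw [hy hsmall]
    have hpow : ‖y‖ ^ ((d : ℝ) + 2 * α) ≤
        (3 / 2) ^ ((d : ℝ) + 2 * α) * (‖ξ‖ ^ ((d : ℝ) + 2 * α))⁻¹ := by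
      rw [← Real.inv_rpow hξ0.le, ← Real.mul_rpow (by norm_num) (by positivity)]
      gcongr
    calc c₀ * ‖ξ‖ ^ ((d : ℝ) + 2 * α)
        = amplitude κ α δ / ((3 / 2) ^ ((d : ℝ) + 2 * α) * (‖ξ‖ ^ ((d : ℝ) + 2 * α))⁻¹) *
            (2 / Real.pi ^ 2 * (1 / 2) ^ 2) := by
          rw [hc₀]; field_simp
      _ ≤ _ := by gcongr
  have hint := hk.integrable_mul_one_sub_cos ξ
  calc c₀ * m * ‖ξ‖ ^ (2 * α)
      = ∫ _ in B, c₀ * ‖ξ‖ ^ ((d : ℝ) + 2 * α) := by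
        rw [setIntegral_const, hvol, smul_eq_mul, Real.rpow_add hξ0, Real.rpow_natCast]
        field_simp
    _ ≤ ∫ y in B, kernel κ α δ χ y * (1 - Real.cos (inner ℝ y ξ)) := by
        refine setIntegral_mono_on_ae (integrableOn_const measure_ball_lt_top.ne) hint.integrableOn
          Metric.isOpen_ball.measurableSet hmain
    _ ≤ symbol (kernel κ α δ χ) ξ := by
        refine setIntegral_le_integral hint ?_
        filter_upwards [hk.nonneg] with y hy using mul_nonneg hy (one_sub_cos_nonneg _)

end Dispersion

/-! ### Fourier transforms of the time slices of test functions. -/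

section SliceFourier

variable {d : ℕ}

/-- The character `x ↦ e^{2πi x·ξ}`. -/
def character (ξ x : Rd d) : ℂ :=
  Complex.exp (((2 * Real.pi * inner ℝ x ξ : ℝ) : ℂ) * Complex.I)

theorem norm_character (ξ x : Rd d) : ‖character ξ x‖ = 1 := Complex.norm_exp_ofReal_mul_I _

@[fun_prop]
theorem continuous_character : Continuous fun q : Rd d × Rd d => character q.1 q.2 := by
  unfold character
  fun_prop

theorem character_add (ξ x y : Rd d) : character ξ (x + y) = character ξ x * character ξ y := by
  rw [character, character, character, ← Complex.exp_add, inner_add_left]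
  push_cast
  ring_nf

theorem character_add_character_neg (ξ y : Rd d) :
    character ξ y + character ξ (-y) =
      ((2 * Real.cos (inner ℝ y ((2 * Real.pi) • ξ)) : ℝ) : ℂ) := by
  rw [character, character, inner_neg_left, inner_smul_right]
  push_cast
  rw [Complex.cos]
  ring_nf

/-- The inverse Fourier transform of `φ(t, ·)`, in the normalization of Mathlib. -/
def sliceFourier (φ : ℝ × Rd d → ℝ) (t : ℝ) (ξ : Rd d) : ℂ :=
  ∫ x, character ξ x * (φ (t, x) : ℂ)

theorem slice_apply (φ : 𝓓(whole (ℝ × Rd d), ℝ)) (t : ℝ) (x : Rd d) : slice φ t x = φ (t, x) :=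
  rfl

theorem fourierInv_testToSchwartz_slice (φ : 𝓓(whole (ℝ × Rd d), ℝ)) (t : ℝ) (ξ : Rd d) :
    𝓕⁻ (testToSchwartz d (slice φ t)) ξ = sliceFourier φ t ξ := by
  rw [SchwartzMap.fourierInv_coe, Real.fourierInv_eq']
  rfl

theorem eq_zero_of_notMem_image_tsupport {F : Type*} [Zero F] {φ : ℝ × Rd d → F} {t : ℝ} {x : Rd d}
    (hx : x ∉ Prod.snd '' tsupport φ) : φ (t, x) = 0 :=
  image_eq_zero_of_notMem_tsupport fun h => hx ⟨_, h, rfl⟩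

theorem isCompact_image_snd_tsupport {F : Type*} [Zero F] {φ : ℝ × Rd d → F}
    (hc : HasCompactSupport φ) : IsCompact (Prod.snd '' tsupport φ) :=
  hc.isCompact.image continuous_snd

theorem continuous_sliceFourier {φ : ℝ × Rd d → ℝ} (hφ : Continuous φ)
    (hc : HasCompactSupport φ) :
    Continuous fun q : ℝ × Rd d => sliceFourier φ q.1 q.2 := by
  have h := continuous_parametric_integral_of_continuous (μ := (volume : Measure (Rd d)))
    (f := fun (q : ℝ × Rd d) x => character q.2 x * (φ (q.1, x) : ℂ)) (by fun_prop)
    (isCompact_image_snd_tsupport hc)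
  refine h.congr fun q => ?_
  refine setIntegral_eq_integral_of_forall_compl_eq_zero fun x hx => ?_
  rw [eq_zero_of_notMem_image_tsupport hx]
  simp

theorem integrable_character_mul {f : Rd d → ℝ} (hf : Continuous f) (hc : HasCompactSupport f)
    (ξ : Rd d) : Integrable fun x => character ξ x * (f x : ℂ) := by
  have : Continuous (character ξ) := continuous_character.comp (by fun_prop : Continuous (ξ, ·))
  refine Continuous.integrable_of_hasCompactSupport (by fun_prop) ?_
  exact (hc.comp_left Complex.ofReal_zero).mul_left

theorem hasCompactSupport_slice {F : Type*} [Zero F] {φ : ℝ × Rd d → F}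
    (hc : HasCompactSupport φ) (t : ℝ) : HasCompactSupport fun x => φ (t, x) :=
  HasCompactSupport.intro (isCompact_image_snd_tsupport hc)
    fun _ hx => eq_zero_of_notMem_image_tsupport hx

theorem hasDerivAt_slice (φ : 𝓓(whole (ℝ × Rd d), ℝ)) (t : ℝ) (x : Rd d) :
    HasDerivAt (fun τ => φ (τ, x)) (timeDeriv φ (t, x)) t := by
  rw [timeDeriv_apply]
  have h1 : Differentiable ℝ φ := φ.contDiff.differentiable (by simp)
  have h2 : Differentiable ℝ fun τ : ℝ => φ (τ, x) := h1.comp (by fun_prop)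
  exact (h2 t).hasDerivAt

theorem hasDerivAt_sliceFourier (φ : 𝓓(whole (ℝ × Rd d), ℝ)) (t : ℝ) (ξ : Rd d) :
    HasDerivAt (fun τ => sliceFourier φ τ ξ) (sliceFourier (timeDeriv φ) t ξ) t := by
  obtain ⟨B, hB⟩ := (timeDeriv φ).continuous.bounded_above_of_compact_support
    (timeDeriv φ).hasCompactSupport
  set K := Prod.snd '' tsupport (timeDeriv φ) with hK
  have hKc : IsCompact K := isCompact_image_snd_tsupport (timeDeriv φ).hasCompactSupport
  have hint : ∀ (ψ : 𝓓(whole (ℝ × Rd d), ℝ)) τ,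
      Integrable fun x => character ξ x * (ψ (τ, x) : ℂ) := fun ψ τ =>
    integrable_character_mul (slice ψ τ).continuous (slice ψ τ).hasCompactSupport ξ
  refine (hasDerivAt_integral_of_dominated_loc_of_deriv_le (s := univ)
    (F := fun τ x => character ξ x * (φ (τ, x) : ℂ))
    (F' := fun τ x => character ξ x * (timeDeriv φ (τ, x) : ℂ))
    (bound := K.indicator fun _ => B) univ_mem
    (Eventually.of_forall fun τ => (hint φ τ).aestronglyMeasurable) (hint φ t)
    (hint (timeDeriv φ) t).aestronglyMeasurable ?_ ?_ ?_).2
  · refine Eventually.of_forall fun x τ _ => ?_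
    by_cases hx : x ∈ K
    · rw [indicator_of_mem hx, norm_mul, norm_character, one_mul, Complex.norm_real]
      exact hB _
    · rw [indicator_of_notMem hx, eq_zero_of_notMem_image_tsupport hx]
      simp
  · exact (integrable_indicator_iff hKc.measurableSet).mpr (integrableOn_const hKc.measure_lt_top.ne)
  · exact Eventually.of_forall fun x τ _ => ((hasDerivAt_slice φ τ x).ofReal_comp).const_mul _

/-- On the Fourier side the nonlocal operator is multiplication by minus its symbol. -/
theorem IsEvenKernel.sliceFourier_nonlocalOp {k : Rd d → ℝ} {r : ℝ} (hk : IsEvenKernel k r)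
    {φ : ℝ × Rd d → ℝ} (hφ : ContDiff ℝ 2 φ) (hc : HasCompactSupport φ) (t : ℝ) (ξ : Rd d) :
    sliceFourier (nonlocalOp k φ) t ξ =
      -(symbol k ((2 * Real.pi) • ξ) : ℂ) * sliceFourier φ t ξ := by
  obtain ⟨C, hC0, hC⟩ := exists_norm_secondDiff_le hφ hc
  set K : Set (Rd d) := Prod.snd '' Metric.cthickening r (tsupport φ) with hK
  have hKc : IsCompact K := hc.isCompact.cthickening.image continuous_snd
  set G : Rd d × Rd d → ℂ := fun q =>
    character ξ q.1 * ((k q.2 • secondDiff φ (t, q.1) q.2 : ℝ) : ℂ) with hG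
  -- Fubini needs joint integrability in `(x, y)`. The quadratic bound controls `y`, and the
  -- thickened support confines `x` to the compact set `K`.
  have hGint : Integrable G (volume.prod volume) := by
    have hb : Integrable (fun q : Rd d × Rd d =>
        K.indicator (fun _ => (1 : ℝ)) q.1 * (C * (‖q.2‖ ^ 2 * k q.2))) (volume.prod volume) :=
      Integrable.mul_prod ((integrable_indicator_iff hKc.measurableSet).mpr
        (integrableOn_const hKc.measure_lt_top.ne)) (hk.integrable.const_mul C)
    refine hb.mono' ?_ ?_
    · have h1 : Continuous fun q : Rd d × Rd d => character ξ q.1 :=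
        continuous_character.comp (by fun_prop : Continuous fun q : Rd d × Rd d => (ξ, q.1))
      have h2 : Continuous fun q : Rd d × Rd d => secondDiff φ (t, q.1) q.2 :=
        (continuous_secondDiff hφ.continuous).comp
          (by fun_prop : Continuous fun q : Rd d × Rd d => ((t, q.1), q.2))
      exact h1.aestronglyMeasurable.mul (Complex.continuous_ofReal.comp_aestronglyMeasurable
        (hk.aestronglyMeasurable.comp_snd.smul h2.aestronglyMeasurable))
    · have h1 := (Measure.quasiMeasurePreserving_snd (μ := (volume : Measure (Rd d)))
        (ν := (volume : Measure (Rd d)))).ae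
        ((hk.smul_secondDiff_eq_zero (φ := φ)).and (hk.norm_smul_secondDiff_le hC))
      filter_upwards [h1] with q hq
      rw [hG, norm_mul, norm_character, one_mul, Complex.norm_real]
      by_cases hx : q.1 ∈ K
      · rw [indicator_of_mem hx, one_mul]
        exact hq.2 _
      · rw [indicator_of_notMem hx, zero_mul, hq.1 (t, q.1) fun h => hx ⟨_, h, rfl⟩, norm_zero]
  -- Translation by `y` becomes multiplication by a character; the translates by `±y` then combine
  -- into the cosine of the symbol.
  have hshift : ∀ y : Rd d, ∫ x, character ξ x * (φ (t, x + y) : ℂ) =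
      character ξ (-y) * sliceFourier φ t ξ := by
    intro y
    rw [sliceFourier, ← integral_const_mul, ← integral_add_right_eq_self
      (fun x => character ξ (-y) * (character ξ x * (φ (t, x) : ℂ))) y]
    congr 1 with x
    rw [← mul_assoc, ← character_add, neg_add_cancel_comm_assoc]
  have hinner : ∀ y : Rd d, ∫ x, G (x, y) =
      ((-2 * (k y * (1 - Real.cos (inner ℝ y ((2 * Real.pi) • ξ)))) : ℝ) : ℂ) *
        sliceFourier φ t ξ := by
    intro y
    have hint : ∀ z : Rd d, Integrable fun x => character ξ x * (φ (t, x + z) : ℂ) := by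
      intro z
      have hcont := hφ.continuous
      refine integrable_character_mul (f := fun x => φ (t, x + z)) (by fun_prop) ?_ ξ
      exact (hasCompactSupport_slice hc t).comp_homeomorph (Homeomorph.addRight z)
    have hsplit : ∀ x, G (x, y) = (k y : ℂ) * (character ξ x * (φ (t, x + y) : ℂ) +
        character ξ x * (φ (t, x + -y) : ℂ) - 2 * (character ξ x * (φ (t, x + 0) : ℂ))) := by
      intro x
      simp only [hG, secondDiff, smul_eq_mul, Prod.mk_add_mk, add_zero, sub_eq_add_neg, Prod.neg_mk,
        neg_zero]
      push_cast
      ring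
    have hadd : Integrable fun x => character ξ x * (φ (t, x + y) : ℂ) +
        character ξ x * (φ (t, x + -y) : ℂ) := (hint y).add (hint (-y))
    simp_rw [hsplit]
    rw [integral_const_mul, integral_sub hadd ((hint 0).const_mul 2),
      integral_add (hint y) (hint (-y)), integral_const_mul, hshift, hshift, hshift, neg_neg,
      neg_zero]
    have h0 : character ξ (0 : Rd d) = 1 := by simp [character]
    have h1 := character_add_character_neg ξ y
    push_cast at h1 ⊢
    rw [h0]
    linear_combination (k y : ℂ) * sliceFourier φ t ξ * h1
  have hLHS : ∀ x, character ξ x * ((nonlocalOp k φ (t, x) : ℝ) : ℂ) = (1 / 2 : ℂ) * ∫ y, G (x, y) := by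
    intro x
    simp only [hG]
    rw [integral_const_mul, nonlocalOp, integral_complex_ofReal]
    push_cast [smul_eq_mul]
    ring
  rw [sliceFourier]
  simp_rw [hLHS]
  rw [integral_const_mul, integral_integral_swap (f := fun x y => G (x, y)) hGint]
  simp_rw [hinner]
  rw [integral_mul_const, integral_complex_ofReal, integral_const_mul, symbol]
  push_cast
  ring

/-- The slice is the composition of `φ` with `x ↦ (t, x)`, an affine map whose linear part has norm
at most one. -/
theorem norm_iteratedFDeriv_slice_le (φ : 𝓓(whole (ℝ × Rd d), ℝ)) (n : ℕ) (t : ℝ) (x : Rd d) :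
    ‖iteratedFDeriv ℝ n (testToSchwartz d (slice φ t)) x‖ ≤
      ‖iteratedFDeriv ℝ n φ (t, x)‖ := by
  have hreal : ‖iteratedFDeriv ℝ n (slice φ t) x‖ ≤ ‖iteratedFDeriv ℝ n φ (t, x)‖ := by
    have h1 : (slice φ t : Rd d → ℝ) =
        (fun z => φ ((t, 0) + z)) ∘ ContinuousLinearMap.inr ℝ ℝ (Rd d) := by
      ext y
      simp [slice_apply]
    have h2 : ContDiff ℝ ((⊤ : ℕ∞) : WithTop ℕ∞) fun z : ℝ × Rd d => φ ((t, 0) + z) :=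
      φ.contDiff.comp (by fun_prop)
    rw [h1, ContinuousLinearMap.iteratedFDeriv_comp_right _ h2 x
      (i := n) (by exact_mod_cast le_top), iteratedFDeriv_comp_add_left]
    refine (ContinuousMultilinearMap.norm_compContinuousLinearMap_le _ _).trans ?_
    have h3 : ∏ _i : Fin n, ‖ContinuousLinearMap.inr ℝ ℝ (Rd d)‖ ≤ 1 :=
      Finset.prod_le_one (fun _ _ => norm_nonneg _)
        fun _ _ => ContinuousLinearMap.norm_inr_le_one ℝ ℝ (Rd d)
    have h4 : (t, (0 : Rd d)) + ContinuousLinearMap.inr ℝ ℝ (Rd d) x = (t, x) := by simp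
    rw [h4]
    exact mul_le_of_le_one_right (norm_nonneg _) h3
  have h5 : (testToSchwartz d (slice φ t) : Rd d → ℂ) =
      Complex.ofRealCLM ∘ (slice φ t : Rd d → ℝ) := rfl
  rw [h5]
  refine (ContinuousLinearMap.norm_iteratedFDeriv_comp_left _ (slice φ t).contDiff.contDiffAt
    (by exact_mod_cast le_top)).trans ?_
  rwa [Complex.ofRealCLM_norm, one_mul]

/-- The Fourier transforms of the time slices of test functions supported in `K` decay rapidly,
uniformly in time, with constants controlled by finitely many seminorms. -/
theorem exists_sliceFourier_le (K : Compacts (ℝ × Rd d)) (M : ℕ) :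
    ∃ (C : ℝ) (S : Finset ℕ), 0 ≤ C ∧ ∀ (f : 𝓓_{K}(ℝ × Rd d, ℝ)) (t : ℝ) (ξ : Rd d),
      (1 + ‖ξ‖) ^ M * ‖sliceFourier f t ξ‖ ≤
        C * (S.sup (ContDiffMapSupportedIn.seminorm ℝ (ℝ × Rd d) ℝ ⊤ K)) f := by
  obtain ⟨R, hR0, hR⟩ := K.isCompact.isBounded.exists_pos_norm_le
  set q₀ : Seminorm ℝ 𝓢(Rd d, ℂ) :=
    (Finset.Iic (M, 0)).sup (schwartzSeminormFamily ℝ (Rd d) ℂ)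
  -- The decay to be proved is controlled by a Schwartz seminorm of the inverse Fourier transform.
  -- By continuity of that transform it is bounded by finitely many seminorms of the slice; on `K`
  -- their polynomial weights are at most `(1 + R)^N`, leaving only derivatives of `f`.
  set q : Seminorm ℝ 𝓢(Rd d, ℂ) := q₀.comp
      ((FourierTransform.fourierInvCLM ℝ 𝓢(Rd d, ℂ) : 𝓢(Rd d, ℂ) →L[ℝ] 𝓢(Rd d, ℂ)) :
        𝓢(Rd d, ℂ) →ₗ[ℝ] 𝓢(Rd d, ℂ)) with hq
  have hqc : Continuous q := by
    have h1 : Continuous q₀ :=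
      (schwartz_withSeminorms ℝ (Rd d) ℂ).finset_sups.continuous_seminorm _
    exact h1.comp (FourierTransform.fourierInvCLM ℝ 𝓢(Rd d, ℂ)).continuous
  obtain ⟨s, C, -, hC⟩ := Seminorm.bound_of_continuous (schwartz_withSeminorms ℝ (Rd d) ℂ) q hqc
  set N := s.sup Prod.fst with hN
  refine ⟨2 ^ M * (C * (1 + R) ^ N), s.image Prod.snd, by positivity, fun f t ξ => ?_⟩
  have hsub : (K : Set (ℝ × Rd d)) ⊆ (whole (ℝ × Rd d) : Set (ℝ × Rd d)) := fun _ _ => trivial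
  set φ : 𝓓(whole (ℝ × Rd d), ℝ) := TestFunction.ofSupportedIn hsub f with hφ
  set P := ((s.image Prod.snd).sup (ContDiffMapSupportedIn.seminorm ℝ (ℝ × Rd d) ℝ ⊤ K)) f with hP
  have hsem : (s.sup (schwartzSeminormFamily ℝ (Rd d) ℂ)) (testToSchwartz d (slice φ t)) ≤
      (1 + R) ^ N * P := by
    refine Seminorm.finset_sup_apply_le (by positivity) fun i hi => ?_
    refine SchwartzMap.seminorm_le_bound ℝ i.1 i.2 _ (by positivity) fun x => ?_
    have h1 := norm_iteratedFDeriv_slice_le φ i.2 t x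
    by_cases hx : (t, x) ∈ K
    · have h2 := ContDiffMapSupportedIn.norm_iteratedFDeriv_apply_le_seminorm_top ℝ
        (i := i.2) (f := f) (x := (t, x))
      have h3 : ContDiffMapSupportedIn.seminorm ℝ (ℝ × Rd d) ℝ ⊤ K i.2 f ≤ P :=
        Seminorm.le_finset_sup_apply (Finset.mem_image_of_mem _ hi)
      have h4 : ‖x‖ ≤ 1 + R := (norm_snd_le (t, x)).trans ((hR _ hx).trans (by linarith))
      have h5 : ‖x‖ ^ i.1 ≤ (1 + R) ^ N := (pow_le_pow_left₀ (norm_nonneg _) h4 _).trans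
        (pow_le_pow_right₀ (by linarith) (Finset.le_sup (f := Prod.fst) hi))
      exact mul_le_mul h5 (h1.trans (h2.trans h3)) (norm_nonneg _) (by positivity)
    · have h0 : iteratedFDeriv ℝ i.2 (f : ℝ × Rd d → ℝ) (t, x) = 0 := by
        by_contra hne
        exact hx (f.tsupport_subset
          (support_iteratedFDeriv_subset (𝕜 := ℝ) i.2 (Function.mem_support.mpr hne)))
      have h2 : ‖iteratedFDeriv ℝ i.2 (testToSchwartz d (slice φ t)) x‖ ≤ 0 := by
        refine h1.trans (le_of_eq ?_)
        change ‖iteratedFDeriv ℝ i.2 (f : ℝ × Rd d → ℝ) (t, x)‖ = 0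
        rw [h0, norm_zero]
      rw [le_antisymm h2 (norm_nonneg _), mul_zero]
      positivity
  have h6 := SchwartzMap.one_add_le_sup_seminorm_apply (𝕜 := ℝ) (m := (M, 0)) le_rfl le_rfl
    (𝓕⁻ (testToSchwartz d (slice φ t))) ξ
  rw [norm_iteratedFDeriv_zero, fourierInv_testToSchwartz_slice] at h6
  have h7 : q (testToSchwartz d (slice φ t)) ≤ C * ((1 + R) ^ N * P) :=
    (hC _).trans (mul_le_mul_of_nonneg_left hsem C.2)
  calc (1 + ‖ξ‖) ^ M * ‖sliceFourier f t ξ‖ ≤ 2 ^ M * q (testToSchwartz d (slice φ t)) := h6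
    _ ≤ 2 ^ M * (C * ((1 + R) ^ N * P)) := by gcongr
    _ = _ := by ring

/-- A test function, as an element of the space of functions supported in its support. -/
def restrictSupport (φ : 𝓓(whole (ℝ × Rd d), ℝ)) :
    𝓓_{(⟨tsupport φ, φ.hasCompactSupport⟩ : Compacts (ℝ × Rd d))}(ℝ × Rd d, ℝ) :=
  ContDiffMapSupportedIn.of_support_subset φ.contDiff subset_closure

theorem exists_sliceFourier_le_of_testFunction (φ : 𝓓(whole (ℝ × Rd d), ℝ)) (M : ℕ) :
    ∃ C, 0 ≤ C ∧ ∀ t ξ, (1 + ‖ξ‖) ^ M * ‖sliceFourier φ t ξ‖ ≤ C := by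
  obtain ⟨C, S, hC, h⟩ := exists_sliceFourier_le (⟨tsupport φ, φ.hasCompactSupport⟩ : Compacts _) M
  exact ⟨_, by positivity, fun t ξ => h (restrictSupport φ) t ξ⟩

theorem sliceFourier_eq_zero {φ : ℝ × Rd d → ℝ} {t : ℝ} (ht : t ∉ Prod.fst '' tsupport φ)
    (ξ : Rd d) : sliceFourier φ t ξ = 0 := by
  rw [sliceFourier, integral_eq_zero_of_ae]
  refine Eventually.of_forall fun x => ?_
  have : φ (t, x) = 0 := image_eq_zero_of_notMem_tsupport fun h => ht ⟨_, h, rfl⟩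
  simp [this]

end SliceFourier

/-! ### Elements of `H^s` as weighted `L²` functions on the Fourier side. -/

section Profile

variable {d : ℕ} {s : ℝ}

/-- The weight `(1 + |ξ|²)^{s/2}`. -/
def weight (s : ℝ) (ξ : Rd d) : ℝ := (1 + ‖ξ‖ ^ 2) ^ (s / 2)

theorem weight_pos (s : ℝ) (ξ : Rd d) : 0 < weight s ξ := by
  unfold weight
  positivity

theorem weight_neg (s : ℝ) (ξ : Rd d) : weight s (-ξ) = weight s ξ := by simp [weight]

theorem weight_mul_weight (s r : ℝ) (ξ : Rd d) : weight s ξ * weight r ξ = weight (s + r) ξ := by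
  rw [weight, weight, weight, ← Real.rpow_add (by positivity), add_div]

theorem weight_zero (ξ : Rd d) : weight 0 ξ = 1 := by simp [weight]

@[fun_prop]
theorem continuous_weight (s : ℝ) : Continuous (weight s : Rd d → ℝ) := by
  unfold weight
  exact Continuous.rpow_const (by fun_prop) fun ξ => Or.inl (by positivity)

theorem hasTemperateGrowth_weight (s : ℝ) :
    (fun ξ : Rd d => ((weight s ξ : ℝ) : ℂ)).HasTemperateGrowth := by
  unfold weight
  fun_prop

theorem integrable_schwartz_smul (ψ : 𝓢(Rd d, ℂ)) (G : Lp (Cd d) 2 (volume : Measure (Rd d))) :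
    Integrable fun ξ => ψ ξ • G ξ :=
  memLp_one_iff_integrable.mp ((Lp.memLp G).smul (r := 1) (ψ.memLp 2 volume))

theorem weight_smul_schwartz_apply (s : ℝ) (ψ : 𝓢(Rd d, ℂ)) (ξ : Rd d) :
    SchwartzMap.smulLeftCLM ℂ (fun ξ : Rd d => ((weight s ξ : ℝ) : ℂ)) ψ ξ =
      (weight s ξ : ℂ) * ψ ξ := by
  rw [SchwartzMap.smulLeftCLM_apply_apply (hasTemperateGrowth_weight s), smul_eq_mul]

theorem weight_smul_weight_smul_schwartz {s r : ℝ} (h : s + r = 0) (ψ : 𝓢(Rd d, ℂ)) :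
    SchwartzMap.smulLeftCLM ℂ (fun ξ : Rd d => ((weight s ξ : ℝ) : ℂ))
      (SchwartzMap.smulLeftCLM ℂ (fun ξ : Rd d => ((weight r ξ : ℝ) : ℂ)) ψ) = ψ := by
  ext ξ
  rw [weight_smul_schwartz_apply, weight_smul_schwartz_apply, ← mul_assoc]
  norm_cast
  rw [weight_mul_weight, h, weight_zero]
  simp

/-- The function `(1 + |ξ|²)^{s/2} 𝓕u(ξ)` in `L²`, for `u` in `H^s`. -/
def Hs.profile : Hs d s →ₗᵢ[ℝ] Lp (Cd d) 2 (volume : Measure (Rd d)) where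
  toFun u := 𝓕 (Hs.bessel u)
  map_add' u v := by rw [map_add, FourierTransform.fourier_add]
  map_smul' c u := by
    rw [map_smul]
    exact (Lp.fourierTransformₗᵢ (Rd d) (Cd d)).toLinearEquiv.toLinearMap.map_smul_of_tower c _
  norm_map' u := by
    change ‖𝓕 (Hs.bessel u)‖ = ‖u‖
    rw [Lp.norm_fourier_eq, Hs.norm_eq]

theorem Hs.integrable_profile (u : Hs d s) (η : 𝓢(Rd d, ℂ)) :
    Integrable fun ξ => ((weight (-s) ξ : ℂ) * 𝓕⁻ η ξ) • u.profile ξ := by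
  simp_rw [← weight_smul_schwartz_apply]
  exact integrable_schwartz_smul _ _

theorem Hs.toTempered_eq (u : Hs d s) :
    u.toTempered = TemperedDistribution.besselPotential (Rd d) (Cd d) (-s)
      (Lp.toTemperedDistributionCLM (Cd d) (volume : Measure (Rd d)) 2 (Hs.bessel u)) := by
  rw [← Hs.besselPotential_toTempered]
  simp

theorem besselPotential_neg_toTempered_apply (G : Lp (Cd d) 2 (volume : Measure (Rd d)))
    (η : 𝓢(Rd d, ℂ)) :
    TemperedDistribution.besselPotential (Rd d) (Cd d) (-s)
      (Lp.toTemperedDistributionCLM (Cd d) (volume : Measure (Rd d)) 2 (𝓕⁻ G)) η =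
      ∫ ξ, ((weight (-s) ξ : ℂ) * 𝓕⁻ η ξ) • G ξ := by
  rw [TemperedDistribution.besselPotential, TemperedDistribution.fourierMultiplierCLM_apply,
    Lp.toTemperedDistributionCLM_apply, Lp.fourier_toTemperedDistribution_eq,
    FourierTransform.fourier_fourierInv_eq, TemperedDistribution.fourierInv_apply,
    TemperedDistribution.smulLeftCLM_apply_apply, Lp.toTemperedDistribution_apply]
  simp_rw [← weight_smul_schwartz_apply]
  rfl

/-- Multiplier and transform are moved onto the test function. Every later identity for elements of
`H^s` is deduced from this pairing. -/
theorem Hs.toTempered_apply (u : Hs d s) (η : 𝓢(Rd d, ℂ)) :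
    u.toTempered η = ∫ ξ, ((weight (-s) ξ : ℂ) * 𝓕⁻ η ξ) • u.profile ξ := by
  rw [← besselPotential_neg_toTempered_apply, Hs.toTempered_eq]
  congr 3
  exact (FourierTransform.fourierInv_fourier_eq (Hs.bessel u)).symm

theorem lp_eq_of_forall_integral_eq {G H : Lp (Cd d) 2 (volume : Measure (Rd d))}
    (h : ∀ ψ : 𝓢(Rd d, ℂ), ∫ ξ, ψ ξ • G ξ = ∫ ξ, ψ ξ • H ξ) : G = H := by
  apply toTemperedDistribution_injective
  ext1 ψ
  simpa [Lp.toTemperedDistributionCLM_apply] using h ψ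

/-- Every Schwartz function is a weighted inverse Fourier transform. -/
theorem weight_mul_fourierInv_fourier (s : ℝ) (ψ : 𝓢(Rd d, ℂ)) (ξ : Rd d) :
    (weight (-s) ξ : ℂ) * 𝓕⁻ (𝓕 (SchwartzMap.smulLeftCLM ℂ
      (fun ξ : Rd d => ((weight s ξ : ℝ) : ℂ)) ψ)) ξ = ψ ξ := by
  rw [FourierTransform.fourierInv_fourier_eq, ← weight_smul_schwartz_apply,
    weight_smul_weight_smul_schwartz (by ring)]

/-- The weighted inverse transforms `weight (-s) · 𝓕⁻ η` exhaust the Schwartz functions, and these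
separate points of `L²`. -/
theorem Hs.profile_eq_of_forall {u : Hs d s} {H : Lp (Cd d) 2 (volume : Measure (Rd d))}
    (h : ∀ η : 𝓢(Rd d, ℂ), u.toTempered η = ∫ ξ, ((weight (-s) ξ : ℂ) * 𝓕⁻ η ξ) • H ξ) :
    u.profile = H := by
  refine lp_eq_of_forall_integral_eq fun ψ => ?_
  have h1 := h (𝓕 (SchwartzMap.smulLeftCLM ℂ (fun ξ : Rd d => ((weight s ξ : ℝ) : ℂ)) ψ))
  rw [Hs.toTempered_apply] at h1
  simpa only [weight_mul_fourierInv_fourier] using h1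

/-- Hermitian symmetry, the property of Fourier transforms of real-valued distributions. -/
def IsHermitianSymm (G : Rd d → Cd d) : Prop :=
  ∀ᵐ ξ, ∀ i, G (-ξ) i = (starRingEnd ℂ) (G ξ i)

theorem ae_neg {p : Rd d → Prop} (h : ∀ᵐ ξ, p ξ) : ∀ᵐ ξ, p (-ξ) :=
  (Measure.measurePreserving_neg (volume : Measure (Rd d))).quasiMeasurePreserving.ae h

theorem IsHermitianSymm.congr {G H : Rd d → Cd d} (hG : IsHermitianSymm G) (h : G =ᵐ[volume] H) :
    IsHermitianSymm H := by
  filter_upwards [hG, h, ae_neg h] with ξ h1 h2 h3 i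
  rw [← h2, ← h3, h1 i]

theorem IsHermitianSymm.smul {G : Rd d → Cd d} (hG : IsHermitianSymm G) {m : Rd d → ℝ}
    (hm : ∀ ξ, m (-ξ) = m ξ) : IsHermitianSymm fun ξ => m ξ • G ξ := by
  filter_upwards [hG] with ξ h i
  simp [h i, hm]

theorem IsHermitianSymm.add {G H : Rd d → Cd d} (hG : IsHermitianSymm G)
    (hH : IsHermitianSymm H) : IsHermitianSymm fun ξ => G ξ + H ξ := by
  filter_upwards [hG, hH] with ξ h1 h2 i
  simp [h1 i, h2 i]

theorem conjS_apply (η : 𝓢(Rd d, ℂ)) (x : Rd d) : conjS η x = (starRingEnd ℂ) (η x) := rfl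

theorem fourierInv_conjS (η : 𝓢(Rd d, ℂ)) (ξ : Rd d) :
    𝓕⁻ (conjS η) ξ = (starRingEnd ℂ) (𝓕⁻ η (-ξ)) := by
  rw [SchwartzMap.fourierInv_coe, SchwartzMap.fourierInv_coe, Real.fourierInv_eq',
    Real.fourierInv_eq', ← integral_conj]
  congr 1 with x
  simp only [smul_eq_mul, map_mul, ← Complex.exp_conj, Complex.conj_ofReal, Complex.conj_I,
    inner_neg_right, conjS_apply]
  congr 2
  push_cast
  ring

theorem integral_coord {f : Rd d → Cd d} (hf : Integrable f) (i : Fin d) :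
    (∫ ξ, f ξ) i = ∫ ξ, f ξ i :=
  ((EuclideanSpace.proj i : Cd d →L[ℂ] ℂ).integral_comp_comm hf).symm

theorem conj_integral_conjS (G : Lp (Cd d) 2 (volume : Measure (Rd d))) (η : 𝓢(Rd d, ℂ))
    (i : Fin d) :
    (starRingEnd ℂ) ((∫ ξ, ((weight (-s) ξ : ℂ) * 𝓕⁻ (conjS η) ξ) • G ξ) i) =
      ∫ ξ, ((weight (-s) ξ : ℂ) * 𝓕⁻ η ξ) * (starRingEnd ℂ) (G (-ξ) i) := by
  have hint : Integrable fun ξ => ((weight (-s) ξ : ℂ) * 𝓕⁻ (conjS η) ξ) • G ξ := by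
    simp_rw [← weight_smul_schwartz_apply]
    exact integrable_schwartz_smul _ _
  rw [integral_coord hint, ← integral_conj, ← integral_neg_eq_self]
  congr 1 with ξ
  simp [fourierInv_conjS, weight_neg]

/-- Complex conjugation of vectors. -/
def conjVec (d : ℕ) : Cd d →L[ℝ] Cd d where
  toFun z := WithLp.toLp 2 fun i => (starRingEnd ℂ) (z i)
  map_add' z w := by ext i; simp
  map_smul' c z := by ext i; simp
  cont := by fun_prop

/-- For a real-valued distribution, the conjugated and reflected profile represents the same
distribution; uniqueness of the profile gives the symmetry. -/
theorem Hs.isHermitianSymm_profile (u : Hs d s) : IsHermitianSymm u.profile := by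
  have hmem : MemLp (fun ξ => conjVec d (u.profile (-ξ))) 2 (volume : Measure (Rd d)) :=
    (conjVec d).comp_memLp' ((Lp.memLp u.profile).comp_measurePreserving
      (Measure.measurePreserving_neg volume))
  have hcoe := hmem.coeFn_toLp
  set H := MemLp.toLp _ hmem
  have heq : u.profile = H := by
    refine Hs.profile_eq_of_forall fun η => ?_
    have hint : Integrable fun ξ => ((weight (-s) ξ : ℂ) * 𝓕⁻ η ξ) • H ξ := by
      simp_rw [← weight_smul_schwartz_apply]
      exact integrable_schwartz_smul _ _
    ext i
    rw [u.isRealValued η i, Hs.toTempered_apply, conj_integral_conjS, integral_coord hint]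
    refine integral_congr_ae ?_
    filter_upwards [hcoe] with ξ hξ
    rw [hξ]
    simp [conjVec]
  have h2 : u.profile =ᵐ[volume] fun ξ => conjVec d (u.profile (-ξ)) := by
    conv_lhs => rw [heq]
    exact hcoe
  filter_upwards [ae_neg h2] with ξ hξ i
  rw [hξ, neg_neg]
  rfl

/-- The element of `H^s` with a given Hermitian profile in `L²`. -/
def Hs.ofProfile (s : ℝ) (G : Lp (Cd d) 2 (volume : Measure (Rd d))) (hG : IsHermitianSymm G) :
    Hs d s :=
  ⟨TemperedDistribution.besselPotential (Rd d) (Cd d) (-s)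
      (Lp.toTemperedDistributionCLM (Cd d) (volume : Measure (Rd d)) 2 (𝓕⁻ G)),
    ⟨𝓕⁻ G, by simp⟩, fun ψ i => by
      rw [besselPotential_neg_toTempered_apply, besselPotential_neg_toTempered_apply,
        conj_integral_conjS]
      have hint : Integrable fun ξ => ((weight (-s) ξ : ℂ) * 𝓕⁻ ψ ξ) • G ξ := by
        simp_rw [← weight_smul_schwartz_apply]
        exact integrable_schwartz_smul _ _
      rw [integral_coord hint]
      refine integral_congr_ae ?_
      filter_upwards [ae_neg hG] with ξ hξ
      have := hξ i
      rw [neg_neg] at this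
      simp [this]⟩

theorem Hs.profile_ofProfile (G : Lp (Cd d) 2 (volume : Measure (Rd d))) (hG : IsHermitianSymm G) :
    (Hs.ofProfile s G hG).profile = G :=
  Hs.profile_eq_of_forall fun η => besselPotential_neg_toTempered_apply G η

theorem Hs.toTempered_mk (T : 𝓢'(Rd d, Cd d)) (hT : T ∈ sobolevSubmodule d s) :
    Hs.toTempered (⟨T, hT⟩ : Hs d s) = T := rfl

theorem Hs.toTempered_incl {r : ℝ} (h : r ≤ s) (u : Hs d s) :
    (Hs.incl h u).toTempered = u.toTempered :=
  Hs.toTempered_mk u.toTempered ⟨u.memSobolev.mono h, u.isRealValued⟩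

theorem Hs.profile_incl {r : ℝ} (h : r ≤ s) (u : Hs d s)
    {H : Lp (Cd d) 2 (volume : Measure (Rd d))}
    (hH : H =ᵐ[volume] fun ξ => weight (r - s) ξ • u.profile ξ) :
    (Hs.incl h u).profile = H := by
  refine Hs.profile_eq_of_forall fun η => ?_
  rw [Hs.toTempered_incl, Hs.toTempered_apply]
  refine integral_congr_ae ?_
  filter_upwards [hH] with ξ hξ
  rw [hξ, ← Complex.coe_smul, smul_smul]
  congr 1
  rw [mul_right_comm]
  norm_cast
  rw [weight_mul_weight]
  congr 3
  ring

/-- The two normalizations differ by a dilation and a constant; the factor `(2π)^d` is the Jacobian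
of the dilation. -/
theorem fourierInv_fourierS (ψ : 𝓢(Rd d, ℂ)) (ξ : Rd d) :
    𝓕⁻ (fourierS d ψ) ξ = (((2 * Real.pi) ^ (-(d : ℝ) / 2) : ℝ) : ℂ) *
      (((2 * Real.pi) ^ d : ℝ) * ψ ((2 * Real.pi) • ξ)) := by
  have ha0 : 0 < 2 * Real.pi := by positivity
  generalize hc : (((2 * Real.pi) ^ (-(d : ℝ) / 2) : ℝ) : ℂ) = c
  have h1 : 𝓕⁻ (𝓕 ψ) ((2 * Real.pi) • ξ) = ψ ((2 * Real.pi) • ξ) := by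
    rw [FourierTransform.fourierInv_fourier_eq]
  have h2 : ∀ x, fourierS d ψ x = c * 𝓕 ψ ((2 * Real.pi)⁻¹ • x) := fun x => by
    rw [← hc]
    rfl
  have h3 := Measure.integral_comp_smul (volume : Measure (Rd d)) (fun v =>
    Complex.exp (((2 * Real.pi * inner ℝ v ((2 * Real.pi) • ξ) : ℝ) : ℂ) * Complex.I) • 𝓕 ψ v)
    (2 * Real.pi)⁻¹
  have hfin : Module.finrank ℝ (Rd d) = d := by simp
  rw [hfin, inv_pow, inv_inv, abs_of_pos (pow_pos ha0 d), Complex.real_smul] at h3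
  rw [← h1, SchwartzMap.fourierInv_coe, SchwartzMap.fourierInv_coe, Real.fourierInv_eq',
    Real.fourierInv_eq', ← h3, ← integral_const_mul]
  congr 1 with x
  rw [h2, inner_smul_left, inner_smul_right, conj_trivial, inv_mul_cancel_left₀ ha0.ne',
    smul_eq_mul, smul_eq_mul]
  ring

/-- The Fourier transform of `u ∈ H^s` in the angular-frequency normalization. -/
theorem Hs.isGivenBy_fourierT (u : Hs d s) :
    IsGivenBy (fourierT d u.toTempered) fun ζ =>
      (((2 * Real.pi) ^ (-(d : ℝ) / 2) : ℝ) : ℂ) •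
        (weight (-s) ((2 * Real.pi)⁻¹ • ζ) • u.profile ((2 * Real.pi)⁻¹ • ζ)) := by
  intro ψ
  have ha0 : 0 < 2 * Real.pi := by positivity
  have hinv := fourierInv_fourierS ψ
  generalize (((2 * Real.pi) ^ (-(d : ℝ) / 2) : ℝ) : ℂ) = c at hinv ⊢
  have happly : fourierT d u.toTempered ψ = u.toTempered (fourierS d ψ) := rfl
  rw [happly, Hs.toTempered_apply]
  have hint := u.integrable_profile (fourierS d ψ)
  generalize (u.profile : Rd d → Cd d) = G at hint ⊢
  set g : Rd d → Cd d := fun ζ =>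
    ψ ζ • c • (weight (-s) ((2 * Real.pi)⁻¹ • ζ) • G ((2 * Real.pi)⁻¹ • ζ)) with hg
  have hform : (fun ξ => ((weight (-s) ξ : ℂ) * 𝓕⁻ (fourierS d ψ) ξ) • G ξ) =
      fun ξ => ((2 * Real.pi) ^ d : ℝ) • g ((2 * Real.pi) • ξ) := by
    ext1 ξ
    rw [hg, hinv]
    simp only [smul_smul, ← Complex.coe_smul, inv_mul_cancel₀ ha0.ne', one_smul]
    congr 1
    ring
  rw [hform] at hint ⊢
  have hne : (2 * Real.pi) ^ d ≠ 0 := (pow_pos ha0 d).ne'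
  refine ⟨(integrable_comp_smul_iff (volume : Measure (Rd d)) g ha0.ne').mp
      ((integrable_smul_iff hne _).mp hint), ?_⟩
  have hfin : Module.finrank ℝ (Rd d) = d := by simp
  rw [integral_smul, Measure.integral_comp_smul, hfin, abs_of_pos (inv_pos.mpr (pow_pos ha0 d)),
    smul_smul, mul_inv_cancel₀ hne, one_smul]

end Profile

/-! ### Families of Fourier multipliers acting on `L²`. -/

section Multiplier

variable {d : ℕ}

theorem memLp_smul {m : Rd d → ℝ} (hm : Continuous m) {C : ℝ} (hC : ∀ ξ, |m ξ| ≤ C)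
    (G : Lp (Cd d) 2 (volume : Measure (Rd d))) : MemLp (fun ξ => m ξ • G ξ) 2 volume := by
  refine (Lp.memLp G).of_le_mul (c := C) (hm.aestronglyMeasurable.smul (Lp.aestronglyMeasurable G))
    (Eventually.of_forall fun ξ => ?_)
  rw [norm_smul]
  gcongr
  exact hC ξ

open scoped Classical in
/-- Multiplication of an `L²` function by a bounded continuous function `m` (zero when the product
is not in `L²`). -/
def multiply (m : Rd d → ℝ) (G : Lp (Cd d) 2 (volume : Measure (Rd d))) :
    Lp (Cd d) 2 (volume : Measure (Rd d)) :=
  if h : MemLp (fun ξ => m ξ • G ξ) 2 volume then h.toLp _ else 0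

theorem coeFn_multiply {m : Rd d → ℝ} (hm : Continuous m) {C : ℝ} (hC : ∀ ξ, |m ξ| ≤ C)
    (G : Lp (Cd d) 2 (volume : Measure (Rd d))) :
    multiply m G =ᵐ[volume] fun ξ => m ξ • G ξ := by
  rw [multiply, dif_pos (memLp_smul hm hC G)]
  exact MemLp.coeFn_toLp _

theorem coeFn_multiply_add_multiply {m n : Rd d → ℝ} (hm : Continuous m) {C : ℝ}
    (hC : ∀ ξ, |m ξ| ≤ C) (hn : Continuous n) {D : ℝ} (hD : ∀ ξ, |n ξ| ≤ D)
    (G H : Lp (Cd d) 2 (volume : Measure (Rd d))) :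
    (multiply m G + multiply n H : Lp (Cd d) 2 (volume : Measure (Rd d))) =ᵐ[volume]
      fun ξ => m ξ • G ξ + n ξ • H ξ := by
  filter_upwards [Lp.coeFn_add (multiply m G) (multiply n H), coeFn_multiply hm hC G,
    coeFn_multiply hn hD H] with ξ h1 h2 h3
  rw [h1, Pi.add_apply, h2, h3]

/-- Dominated convergence with majorant `|2C G|²`. The bounds `B i` only put each product in `L²`;
the uniform constant `C` is required only eventually along the filter. -/
theorem tendsto_multiply {ι : Type*} {l : Filter ι} [l.IsCountablyGenerated] {m : ι → Rd d → ℝ}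
    {m₀ : Rd d → ℝ} {C : ℝ} {B : ι → ℝ} (hm : ∀ i, Continuous (m i)) (hm₀ : Continuous m₀)
    (hB : ∀ i ξ, |m i ξ| ≤ B i)
    (hC : ∀ᶠ i in l, ∀ ξ, |m i ξ| ≤ C) (hC₀ : ∀ ξ, |m₀ ξ| ≤ C)
    (hlim : ∀ ξ, Tendsto (fun i => m i ξ) l (𝓝 (m₀ ξ)))
    (G : Lp (Cd d) 2 (volume : Measure (Rd d))) :
    Tendsto (fun i => multiply (m i) G) l (𝓝 (multiply m₀ G)) := by
  rw [Lp.tendsto_Lp_iff_tendsto_eLpNorm']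
  have hnorm : ∀ i, eLpNorm (⇑(multiply (m i) G) - ⇑(multiply m₀ G)) 2 volume =
      (∫⁻ ξ, ‖(m i ξ - m₀ ξ) • G ξ‖ₑ ^ (2 : ℝ)) ^ (1 / 2 : ℝ) := by
    intro i
    have hae : ⇑(multiply (m i) G) - ⇑(multiply m₀ G) =ᵐ[volume]
        fun ξ => (m i ξ - m₀ ξ) • G ξ := by
      filter_upwards [coeFn_multiply (hm i) (hB i) G, coeFn_multiply hm₀ hC₀ G] with ξ h1 h2
      rw [Pi.sub_apply, h1, h2, sub_smul]
    rw [eLpNorm_congr_ae hae, eLpNorm_eq_lintegral_rpow_enorm_toReal (by norm_num) (by norm_num)]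
    norm_num
  simp_rw [hnorm]
  have hzero : Tendsto (fun i => ∫⁻ ξ, ‖(m i ξ - m₀ ξ) • G ξ‖ₑ ^ (2 : ℝ)) l (𝓝 (∫⁻ _ : Rd d, 0)) := by
    have hfin : ∫⁻ ξ, ‖(2 * C) • G ξ‖ₑ ^ (2 : ℝ) ≠ ⊤ := by
      have h1 := ((Lp.memLp G).const_smul (2 * C)).eLpNorm_lt_top
      rw [eLpNorm_lt_top_iff_lintegral_rpow_enorm_lt_top (by norm_num) (by norm_num)] at h1
      simpa using h1.ne
    refine tendsto_lintegral_filter_of_dominated_convergence'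
      (fun ξ => ‖(2 * C) • G ξ‖ₑ ^ (2 : ℝ)) ?_ ?_ hfin ?_
    · refine Eventually.of_forall fun i => AEMeasurable.pow_const (AEStronglyMeasurable.enorm ?_) _
      exact ((hm i).sub hm₀).aestronglyMeasurable.smul (Lp.aestronglyMeasurable G)
    · filter_upwards [hC] with i hi
      refine Eventually.of_forall fun ξ => ?_
      gcongr
      rw [enorm_le_iff_norm_le, norm_smul, norm_smul]
      gcongr
      rw [Real.norm_eq_abs, Real.norm_eq_abs]
      calc |m i ξ - m₀ ξ| ≤ |m i ξ| + |m₀ ξ| := abs_sub _ _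
        _ ≤ 2 * C := by linarith [hi ξ, hC₀ ξ]
        _ ≤ _ := le_abs_self _
    · refine Eventually.of_forall fun ξ => ?_
      have h1 : Tendsto (fun i => (m i ξ - m₀ ξ) • G ξ) l (𝓝 0) := by
        have := ((hlim ξ).sub_const (m₀ ξ)).smul_const (G ξ)
        rwa [sub_self, zero_smul] at this
      have h2 := (ENNReal.continuous_rpow_const (y := 2)).tendsto 0 |>.comp
        (by simpa using h1.enorm)
      simpa [Function.comp_def] using h2
  rw [lintegral_zero] at hzero
  have h3 := (ENNReal.continuous_rpow_const (y := 1 / 2)).tendsto 0 |>.comp hzero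
  rw [ENNReal.zero_rpow_of_pos (by norm_num)] at h3
  exact h3

theorem continuous_multiply {m : ℝ → Rd d → ℝ} (hm : Continuous fun q : ℝ × Rd d => m q.1 q.2)
    {B : ℝ → ℝ} (hB : Monotone B) (hmB : ∀ t ξ, |m t ξ| ≤ B |t|)
    (G : Lp (Cd d) 2 (volume : Measure (Rd d))) : Continuous fun t => multiply (m t) G := by
  refine continuous_iff_continuousAt.mpr fun t => ?_
  have hm' : ∀ t, Continuous (m t) := fun t => hm.comp (by fun_prop : Continuous (t, ·))
  refine tendsto_multiply hm' (hm' t) hmB (C := B (|t| + 1)) ?_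
    (fun ξ => (hmB t ξ).trans (hB (by linarith))) ?_ G
  · filter_upwards [Metric.ball_mem_nhds t one_pos] with τ hτ ξ
    refine (hmB τ ξ).trans (hB ?_)
    have h1 : |τ - t| < 1 := by simpa [Real.dist_eq] using hτ
    have h2 := abs_sub_abs_le_abs_sub τ t
    linarith
  · exact fun ξ => (hm.comp (by fun_prop : Continuous (·, ξ))).tendsto t

/-- By the mean value inequality a uniform bound on `m'` also bounds the difference quotients of
`m`. As these converge pointwise, `tendsto_multiply` applies to them. -/
theorem hasDerivAt_multiply {m m' : ℝ → Rd d → ℝ} (hm : Continuous fun q : ℝ × Rd d => m q.1 q.2)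
    (hm' : Continuous fun q : ℝ × Rd d => m' q.1 q.2) {B : ℝ → ℝ} (hmB : ∀ t ξ, |m t ξ| ≤ B t)
    {C : ℝ} (hC : ∀ t ξ, |m' t ξ| ≤ C) (hd : ∀ t ξ, HasDerivAt (fun τ => m τ ξ) (m' t ξ) t)
    (G : Lp (Cd d) 2 (volume : Measure (Rd d))) (t : ℝ) :
    HasDerivAt (fun t => multiply (m t) G) (multiply (m' t) G) t := by
  have hmt : ∀ t, Continuous (m t) := fun t => hm.comp (by fun_prop : Continuous (t, ·))
  have hmt' : ∀ t, Continuous (m' t) := fun t => hm'.comp (by fun_prop : Continuous (t, ·))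
  have hq : ∀ τ, Continuous fun ξ => slope (fun τ => m τ ξ) t τ := by
    intro τ
    simp only [slope_def_field]
    exact ((hmt τ).sub (hmt t)).div_const _
  have hqC : ∀ τ ξ, |slope (fun τ => m τ ξ) t τ| ≤ C := by
    intro τ ξ
    have h1 := Convex.norm_image_sub_le_of_norm_hasDerivWithin_le (s := univ) (x := t) (y := τ)
      (fun τ _ => (hd τ ξ).hasDerivWithinAt) (fun τ _ => hC τ ξ) convex_univ trivial trivial
    rw [slope_def_field, abs_div]
    refine div_le_of_le_mul₀ (abs_nonneg _) ((abs_nonneg _).trans (hC t ξ)) h1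
  rw [hasDerivAt_iff_tendsto_slope]
  refine (tendsto_multiply hq (hmt' t) hqC (Eventually.of_forall hqC) (hC t)
    (fun ξ => hasDerivAt_iff_tendsto_slope.mp (hd t ξ)) G).congr fun τ => ?_
  apply Lp.ext
  rw [slope_def_module]
  filter_upwards [coeFn_multiply (hq τ) (hqC τ) G, coeFn_multiply (hmt τ) (hmB τ) G,
    coeFn_multiply (hmt t) (hmB t) G, Lp.coeFn_smul (τ - t)⁻¹ (multiply (m τ) G - multiply (m t) G),
    Lp.coeFn_sub (multiply (m τ) G) (multiply (m t) G)] with ξ h1 h2 h3 h4 h5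
  rw [h1, h4, Pi.smul_apply, h5, Pi.sub_apply, h2, h3, slope_def_module, ← sub_smul, smul_smul,
    smul_eq_mul]

end Multiplier

/-! ### The multiplier `sin(ωt)/ω`. -/

section SinDiv

/-- Writing the quotient through `Real.sinc` makes joint continuity across `ω = 0` and the bound by
`|t|` immediate. -/
theorem sinDiv_eq (ω t : ℝ) : sinDiv ω t = t * Real.sinc (ω * t) := by
  unfold sinDiv
  split_ifs with h
  · simp [h]
  · rcases eq_or_ne t 0 with rfl | ht
    · simp
    · rw [Real.sinc_of_ne_zero (mul_ne_zero h ht)]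
      field_simp

theorem continuous_sinDiv : Continuous fun q : ℝ × ℝ => sinDiv q.1 q.2 := by
  simp_rw [sinDiv_eq]
  have := Real.continuous_sinc
  fun_prop

theorem abs_sinDiv_le (ω t : ℝ) : |sinDiv ω t| ≤ |t| := by
  rw [sinDiv_eq, abs_mul]
  exact mul_le_of_le_one_right (abs_nonneg _) (Real.abs_sinc_le_one _)

theorem mul_abs_sinDiv_le {ω : ℝ} (hω : 0 ≤ ω) (t : ℝ) : ω * |sinDiv ω t| ≤ 1 := by
  unfold sinDiv
  split_ifs with h
  · simp [h]
  · rw [abs_div, abs_of_nonneg hω, mul_div_cancel₀ _ h]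
    exact Real.abs_sin_le_one _

theorem mul_sinDiv (ω t : ℝ) : ω * sinDiv ω t = Real.sin (ω * t) := by
  unfold sinDiv
  split_ifs with h
  · simp [h]
  · field_simp

theorem sinDiv_zero_right (ω : ℝ) : sinDiv ω 0 = 0 := by simp [sinDiv]

theorem hasDerivAt_sinDiv (ω t : ℝ) : HasDerivAt (sinDiv ω) (Real.cos (ω * t)) t := by
  unfold sinDiv
  split_ifs with h
  · simpa [h] using hasDerivAt_id' t
  · have h1 : HasDerivAt (fun t => Real.sin (ω * t)) (Real.cos (ω * t) * (ω * 1)) t :=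
      ((hasDerivAt_id t).const_mul ω).sin
    have h2 := h1.div_const ω
    rwa [mul_one, mul_div_cancel_right₀ _ h] at h2

theorem hasDerivAt_cos_mul (ω t : ℝ) :
    HasDerivAt (fun t => Real.cos (ω * t)) (-(ω * Real.sin (ω * t))) t := by
  have h1 : HasDerivAt (fun t => Real.cos (ω * t)) (-Real.sin (ω * t) * (ω * 1)) t :=
    ((hasDerivAt_id t).const_mul ω).cos
  convert h1 using 1
  ring

end SinDiv

/-! ### The solution curve and its regularity in time. -/

section Evolution

variable {d : ℕ} {s α : ℝ}

/-- The bounds on a dispersion relation `W` of order `α` that make the Cauchy problem well-posed. -/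
structure IsDispersion (α : ℝ) (W : Rd d → ℝ) : Prop where
  continuous : Continuous W
  nonneg : ∀ ξ, 0 ≤ W ξ
  neg_apply : ∀ ξ, W (-ξ) = W ξ
  upper : ∃ C, ∀ ξ, weight (-α) ξ * W ξ ≤ C
  lower : ∃ C, 0 ≤ C ∧ ∀ ξ, weight α ξ ≤ C * (1 + W ξ)

variable {W : Rd d → ℝ}

/-- The gain of `α` derivatives: `weight α` is at most `C(1 + W)`, where the `1` is paired with
`|sin(Wt)/W| ≤ |t|` and the `W` with `|sin(Wt)| ≤ 1`. -/
theorem IsDispersion.exists_weight_mul_sinDiv_le (hW : IsDispersion α W) :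
    ∃ C, 0 ≤ C ∧ ∀ t ξ, |weight α ξ * sinDiv (W ξ) t| ≤ C * (1 + |t|) := by
  obtain ⟨C, hC, h⟩ := hW.lower
  refine ⟨C, hC, fun t ξ => ?_⟩
  rw [abs_mul, abs_of_pos (weight_pos α ξ)]
  calc weight α ξ * |sinDiv (W ξ) t| ≤ C * (1 + W ξ) * |sinDiv (W ξ) t| := by
        gcongr; exact h ξ
    _ = C * (|sinDiv (W ξ) t| + W ξ * |sinDiv (W ξ) t|) := by ring
    _ ≤ C * (|t| + 1) := by
        exact mul_le_mul_of_nonneg_left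
          (add_le_add (abs_sinDiv_le _ _) (mul_abs_sinDiv_le (hW.nonneg ξ) t)) hC
    _ = _ := by ring

/-- The profile of the solution at time `t`. -/
def evolutionProfile (α : ℝ) (W : Rd d → ℝ) (G₀ G₁ : Lp (Cd d) 2 (volume : Measure (Rd d)))
    (t : ℝ) : Lp (Cd d) 2 (volume : Measure (Rd d)) :=
  -- The profile of `v₀` carries the weight of order `s - α`; the factor `weight α` raises it to the
  -- order `s` of the solution.
  multiply (fun ξ => Real.cos (W ξ * t)) G₀ + multiply (fun ξ => weight α ξ * sinDiv (W ξ) t) G₁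

theorem IsDispersion.continuous_cos (hW : IsDispersion α W) :
    Continuous fun q : ℝ × Rd d => Real.cos (W q.2 * q.1) := by
  have := hW.continuous
  fun_prop

theorem IsDispersion.continuous_sinDiv (hW : IsDispersion α W) :
    Continuous fun q : ℝ × Rd d => sinDiv (W q.2) q.1 := by
  have := hW.continuous
  exact Peridynamics.continuous_sinDiv.comp (by fun_prop : Continuous fun q : ℝ × Rd d => (W q.2, q.1))

theorem IsDispersion.continuous_weight_mul_sinDiv (hW : IsDispersion α W) :
    Continuous fun q : ℝ × Rd d => weight α q.2 * sinDiv (W q.2) q.1 := by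
  have := hW.continuous_sinDiv
  fun_prop

theorem IsDispersion.coeFn_evolutionProfile (hW : IsDispersion α W)
    (G₀ G₁ : Lp (Cd d) 2 (volume : Measure (Rd d))) (t : ℝ) :
    evolutionProfile α W G₀ G₁ t =ᵐ[volume] fun ξ =>
      Real.cos (W ξ * t) • G₀ ξ + (weight α ξ * sinDiv (W ξ) t) • G₁ ξ := by
  obtain ⟨C, hC, h⟩ := hW.exists_weight_mul_sinDiv_le
  have hpair : Continuous fun ξ : Rd d => (t, ξ) := by fun_prop
  have c0 : Continuous fun ξ => Real.cos (W ξ * t) := hW.continuous_cos.comp hpair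
  have c1 : Continuous fun ξ => weight α ξ * sinDiv (W ξ) t :=
    (continuous_weight α).mul (Peridynamics.continuous_sinDiv.comp
      (hW.continuous.prodMk continuous_const))
  exact coeFn_multiply_add_multiply c0 (C := 1) (fun ξ => Real.abs_cos_le_one _) c1 (h t) G₀ G₁

theorem IsDispersion.continuous_evolutionProfile (hW : IsDispersion α W)
    (G₀ G₁ : Lp (Cd d) 2 (volume : Measure (Rd d))) :
    Continuous (evolutionProfile α W G₀ G₁) := by
  obtain ⟨C, hC, h⟩ := hW.exists_weight_mul_sinDiv_le
  refine (continuous_multiply hW.continuous_cos (B := fun _ => 1) monotone_const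
    (fun t ξ => Real.abs_cos_le_one _) G₀).add (continuous_multiply
      hW.continuous_weight_mul_sinDiv (B := fun t => C * (1 + t)) ?_ h G₁)
  intro a b hab
  simp only
  gcongr

theorem isHermitianSymm_evolutionProfile (hW : IsDispersion α W)
    {G₀ G₁ : Lp (Cd d) 2 (volume : Measure (Rd d))} (h₀ : IsHermitianSymm G₀)
    (h₁ : IsHermitianSymm G₁) (t : ℝ) : IsHermitianSymm (evolutionProfile α W G₀ G₁ t) := by
  refine IsHermitianSymm.congr ?_ (hW.coeFn_evolutionProfile G₀ G₁ t).symm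
  exact (h₀.smul fun ξ => by rw [hW.neg_apply]).add
    (h₁.smul fun ξ => by rw [hW.neg_apply, weight_neg])

/-- The solution of the Cauchy problem with dispersion relation `W`. -/
def evolution (hW : IsDispersion α W) (u₀ : Hs d s) (v₀ : Hs d (s - α)) (t : ℝ) : Hs d s :=
  Hs.ofProfile s (evolutionProfile α W u₀.profile v₀.profile t)
    (isHermitianSymm_evolutionProfile hW u₀.isHermitianSymm_profile v₀.isHermitianSymm_profile t)

theorem profile_evolution (hW : IsDispersion α W) (u₀ : Hs d s) (v₀ : Hs d (s - α)) (t : ℝ) :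
    (evolution hW u₀ v₀ t).profile = evolutionProfile α W u₀.profile v₀.profile t :=
  Hs.profile_ofProfile _ _

theorem continuous_evolution (hW : IsDispersion α W) (u₀ : Hs d s) (v₀ : Hs d (s - α)) :
    Continuous (evolution hW u₀ v₀) := by
  rw [← Hs.profile.isometry.comp_continuous_iff]
  exact (hW.continuous_evolutionProfile _ _).congr fun t => (profile_evolution hW u₀ v₀ t).symm

/-- A linear isometry reflects the little-o estimate that defines the derivative, once the
derivative of the profiles is known to be the profile of an element `f'`. -/
theorem hasDerivAt_of_profile {f : ℝ → Hs d s} {f' : Hs d s} {t : ℝ}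
    (h : HasDerivAt (fun t => (f t).profile) f'.profile t) : HasDerivAt f f' t := by
  rw [hasDerivAt_iff_isLittleO] at h ⊢
  refine Asymptotics.IsLittleO.of_norm_left (h.norm_left.congr_left fun τ => ?_)
  rw [← map_sub, ← map_smul, ← map_sub, LinearIsometry.norm_map]

/-- In `H^{s-α}` the profile is multiplied by `weight (-α)`, and the multipliers become `m₀` and
`m₁`. Their time derivatives `n₀` and `n₁` are bounded uniformly in time and frequency because
`weight (-α) · W` is bounded. -/
theorem contDiff_incl_evolution (hα : 0 ≤ α) (hW : IsDispersion α W) (u₀ : Hs d s)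
    (v₀ : Hs d (s - α)) :
    ContDiff ℝ 1 fun t => Hs.incl (sub_le_self s hα) (evolution hW u₀ v₀ t) := by
  obtain ⟨C, hC⟩ := hW.upper
  have hWc := hW.continuous
  have hsd := hW.continuous_sinDiv
  set G₀ := u₀.profile
  set G₁ := v₀.profile
  set m₀ : ℝ → Rd d → ℝ := fun t ξ => weight (-α) ξ * Real.cos (W ξ * t) with hm₀
  set m₁ : ℝ → Rd d → ℝ := fun t ξ => sinDiv (W ξ) t with hm₁
  set n₀ : ℝ → Rd d → ℝ := fun t ξ => -(weight (-α) ξ * W ξ * Real.sin (W ξ * t)) with hn₀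
  set n₁ : ℝ → Rd d → ℝ := fun t ξ => Real.cos (W ξ * t) with hn₁
  have cm₀ : Continuous fun q : ℝ × Rd d => m₀ q.1 q.2 := by fun_prop
  have cm₁ : Continuous fun q : ℝ × Rd d => m₁ q.1 q.2 := hsd
  have cn₀ : Continuous fun q : ℝ × Rd d => n₀ q.1 q.2 := by fun_prop
  have cn₁ : Continuous fun q : ℝ × Rd d => n₁ q.1 q.2 := by fun_prop
  have slice : ∀ {m : ℝ → Rd d → ℝ}, (Continuous fun q : ℝ × Rd d => m q.1 q.2) →
      ∀ t, Continuous (m t) := fun h t => h.comp (by fun_prop : Continuous (t, ·))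
  have bm₀ : ∀ t ξ, |m₀ t ξ| ≤ 1 := fun t ξ => by
    have hw : weight (-α) ξ ≤ 1 :=
      Real.rpow_le_one_of_one_le_of_nonpos (by nlinarith [sq_nonneg ‖ξ‖]) (by linarith)
    rw [hm₀, abs_mul, abs_of_pos (weight_pos _ _)]
    exact mul_le_one₀ hw (abs_nonneg _) (Real.abs_cos_le_one _)
  have bm₁ : ∀ t ξ, |m₁ t ξ| ≤ |t| := fun t ξ => abs_sinDiv_le _ _
  have bn₀ : ∀ t ξ, |n₀ t ξ| ≤ C := fun t ξ => by
    have h0 : 0 ≤ weight (-α) ξ * W ξ := mul_nonneg (weight_pos _ _).le (hW.nonneg ξ)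
    rw [hn₀, abs_neg, abs_mul, abs_of_nonneg h0]
    exact (mul_le_of_le_one_right h0 (Real.abs_sin_le_one _)).trans (hC ξ)
  have bn₁ : ∀ t ξ, |n₁ t ξ| ≤ 1 := fun t ξ => Real.abs_cos_le_one _
  have dm₀ : ∀ t ξ, HasDerivAt (fun τ => m₀ τ ξ) (n₀ t ξ) t := fun t ξ =>
    ((hasDerivAt_cos_mul (W ξ) t).const_mul (weight (-α) ξ)).congr_deriv (by simp only [hn₀]; ring)
  have dm₁ : ∀ t ξ, HasDerivAt (fun τ => m₁ τ ξ) (n₁ t ξ) t := fun t ξ =>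
    hasDerivAt_sinDiv (W ξ) t
  have hprof : ∀ t, (Hs.incl (sub_le_self s hα) (evolution hW u₀ v₀ t)).profile =
      multiply (m₀ t) G₀ + multiply (m₁ t) G₁ := by
    intro t
    refine Hs.profile_incl _ _ ?_
    rw [profile_evolution]
    filter_upwards [coeFn_multiply_add_multiply (slice cm₀ t) (bm₀ t) (slice cm₁ t) (bm₁ t) G₀ G₁,
      hW.coeFn_evolutionProfile G₀ G₁ t] with ξ h1 h2
    have hw : weight (-α) ξ * weight α ξ = 1 := by
      rw [weight_mul_weight, neg_add_cancel, weight_zero]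
    rw [h1, h2, smul_add, smul_smul, smul_smul, ← mul_assoc,
      show s - α - s = -α by ring, hw, one_mul]
  -- Hermitian symmetry makes the candidate derivative the profile of a real-valued element of
  -- `H^{s-α}`.
  have hherm : ∀ t, IsHermitianSymm (multiply (n₀ t) G₀ + multiply (n₁ t) G₁ :
      Lp (Cd d) 2 (volume : Measure (Rd d))) := by
    intro t
    have h0 : IsHermitianSymm fun ξ => n₀ t ξ • G₀ ξ + n₁ t ξ • G₁ ξ :=
      (u₀.isHermitianSymm_profile.smul fun ξ => by simp only [hn₀, weight_neg, hW.neg_apply]).add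
        (v₀.isHermitianSymm_profile.smul fun ξ => by simp only [hn₁, hW.neg_apply])
    exact h0.congr
      (coeFn_multiply_add_multiply (slice cn₀ t) (bn₀ t) (slice cn₁ t) (bn₁ t) G₀ G₁).symm
  have hderiv : ∀ t, HasDerivAt (fun t => Hs.incl (sub_le_self s hα) (evolution hW u₀ v₀ t))
      (Hs.ofProfile (s - α) _ (hherm t)) t := by
    intro t
    refine hasDerivAt_of_profile ?_
    rw [Hs.profile_ofProfile]
    simp_rw [hprof]
    exact (hasDerivAt_multiply cm₀ cn₀ (B := fun _ => 1) bm₀ bn₀ dm₀ G₀ t).add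
      (hasDerivAt_multiply cm₁ cn₁ bm₁ bn₁ dm₁ G₁ t)
  rw [contDiff_one_iff_deriv]
  refine ⟨fun t => (hderiv t).differentiableAt, ?_⟩
  rw [funext fun t => (hderiv t).deriv, ← Hs.profile.isometry.comp_continuous_iff]
  simp only [Function.comp_def, Hs.profile_ofProfile]
  exact (continuous_multiply cn₀ (B := fun _ => C) monotone_const bn₀ G₀).add
    (continuous_multiply cn₁ (B := fun _ => 1) monotone_const bn₁ G₁)

end Evolution

/-! ### The peridynamics dispersion relation has order `α`. -/

section DispersionRelation

variable {d : ℕ} {κ α δ : ℝ} {χ : ℝ → ℝ}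

theorem norm_rpow_le_weight (hα₀ : 0 ≤ α) (ξ : Rd d) : ‖ξ‖ ^ α ≤ weight α ξ := by
  have h : ‖ξ‖ ^ α = (‖ξ‖ ^ 2) ^ (α / 2) := by
    rw [← Real.rpow_natCast, ← Real.rpow_mul (norm_nonneg _)]
    congr 1
    push_cast
    ring
  rw [h, weight]
  exact Real.rpow_le_rpow (by positivity) (by linarith) (by linarith)

theorem isDispersion_dispersion (hd : 1 ≤ d) (hκ : 0 < κ) (hα₀ : 0 < α) (hα₁ : α < 1) (hδ : 0 < δ)
    (hχ : IsCutoff χ) :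
    IsDispersion α fun ξ : Rd d => dispersion κ α δ χ ((2 * Real.pi) • ξ) := by
  have hk := isEvenKernel_kernel (d := d) hd hκ hα₀ hα₁ hδ hχ
  have hπ : 0 < 2 * Real.pi := by positivity
  have hsq : ∀ (x : ℝ), 0 ≤ x → x ^ (2 * α) = (x ^ α) ^ 2 := fun x hx => by
    rw [mul_comm, Real.rpow_mul hx, Real.rpow_two]
  simp_rw [dispersion_eq_sqrt_symbol]
  refine ⟨?_, fun ξ => Real.sqrt_nonneg _, fun ξ => by rw [smul_neg, symbol_neg], ?_, ?_⟩
  · have := hk.continuous_symbol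
    fun_prop
  · obtain ⟨C, hC, h⟩ := exists_symbol_kernel_le (d := d) hd hκ hα₀ hα₁ hδ hχ
    refine ⟨√C * (2 * Real.pi) ^ α, fun ξ => ?_⟩
    have h1 : √(symbol (kernel κ α δ χ) ((2 * Real.pi) • ξ)) ≤
        √C * ((2 * Real.pi) ^ α * weight α ξ) := by
      refine (Real.sqrt_le_sqrt (h _)).trans ?_
      rw [Real.sqrt_mul hC, hsq _ (norm_nonneg _), Real.sqrt_sq (by positivity), norm_smul,
        Real.norm_of_nonneg hπ.le, Real.mul_rpow hπ.le (norm_nonneg _)]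
      gcongr
      exact norm_rpow_le_weight hα₀.le ξ
    have hw : weight (-α) ξ * weight α ξ = 1 := by
      rw [weight_mul_weight, neg_add_cancel, weight_zero]
    have hw0 := weight_pos (-α) ξ
    calc _ ≤ weight (-α) ξ * (√C * ((2 * Real.pi) ^ α * weight α ξ)) := by gcongr
      _ = √C * (2 * Real.pi) ^ α * (weight (-α) ξ * weight α ξ) := by ring
      _ = _ := by rw [hw, mul_one]
  · obtain ⟨c, hc, h⟩ := exists_le_symbol_kernel (d := d) hd hκ hα₀ hα₁ hδ hχ
    -- `R` is the radius at which the angular frequency `2π‖ξ‖` reaches `3/δ`. Below it `weight α`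
    -- is at most `A`; above it `1 + ‖ξ‖² ≤ (R^{-2} + 1)‖ξ‖²`, which with the lower bound on the
    -- symbol gives `B`.
    set R : ℝ := 3 / δ / (2 * Real.pi) with hR
    have hR0 : 0 < R := by positivity
    set A : ℝ := (1 + R ^ 2) ^ (α / 2) with hA
    set B : ℝ := ((R ^ 2)⁻¹ + 1) ^ (α / 2) / (√c * (2 * Real.pi) ^ α) with hB
    have hc' : 0 < √c := Real.sqrt_pos.mpr hc
    have hpos : 0 < √c * (2 * Real.pi) ^ α := by positivity
    refine ⟨A + B, by positivity, fun ξ => ?_⟩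
    set ω := √(symbol (kernel κ α δ χ) ((2 * Real.pi) • ξ)) with hω
    have hω0 : 0 ≤ ω := Real.sqrt_nonneg _
    have hA0 : 0 ≤ A := by positivity
    have hB0 : 0 ≤ B := by positivity
    rcases lt_or_ge ‖ξ‖ R with hlt | hge
    · have h1 : weight α ξ ≤ A := by
        rw [weight, hA]
        gcongr
      nlinarith [mul_nonneg hA0 hω0, mul_nonneg hB0 hω0]
    · have hn : ‖(2 * Real.pi) • ξ‖ = 2 * Real.pi * ‖ξ‖ := by
        rw [norm_smul, Real.norm_of_nonneg hπ.le]
      have hξ : 3 / δ ≤ ‖(2 * Real.pi) • ξ‖ := by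
        rw [hn, mul_comm]
        exact (div_le_iff₀ hπ).mp hge
      have h1 : √c * (2 * Real.pi) ^ α * ‖ξ‖ ^ α ≤ ω := by
        have h2 := Real.sqrt_le_sqrt (h _ hξ)
        rwa [Real.sqrt_mul hc.le, hsq _ (norm_nonneg _), Real.sqrt_sq (by positivity), hn,
          Real.mul_rpow hπ.le (norm_nonneg _), ← mul_assoc] at h2
      have h3 : weight α ξ ≤ ((R ^ 2)⁻¹ + 1) ^ (α / 2) * ‖ξ‖ ^ α := by
        have h4 : ‖ξ‖ ^ α = (‖ξ‖ ^ 2) ^ (α / 2) := by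
          rw [← Real.rpow_natCast, ← Real.rpow_mul (norm_nonneg _)]
          congr 1
          push_cast
          ring
        rw [weight, h4, ← Real.mul_rpow (by positivity) (by positivity)]
        refine Real.rpow_le_rpow (by positivity) ?_ (by linarith)
        rw [add_mul, one_mul]
        gcongr
        rw [inv_mul_eq_div, one_le_div (by positivity)]
        gcongr
      have h5 : weight α ξ ≤ B * ω := by
        refine h3.trans ?_
        calc ((R ^ 2)⁻¹ + 1) ^ (α / 2) * ‖ξ‖ ^ α
            = B * (√c * (2 * Real.pi) ^ α * ‖ξ‖ ^ α) := by
              rw [hB]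
              field_simp
          _ ≤ B * ω := by gcongr
      nlinarith [mul_nonneg hA0 hω0]

end DispersionRelation

/-! ### Polynomial growth of Fourier transforms of Sobolev data. -/

section Growth

variable {d : ℕ}

theorem weight_le_rpow (s : ℝ) (ξ : Rd d) : weight s ξ ≤ (1 + ‖ξ‖) ^ |s| := by
  have h1 : (1 : ℝ) ≤ 1 + ‖ξ‖ ^ 2 := by nlinarith [sq_nonneg ‖ξ‖]
  calc weight s ξ ≤ (1 + ‖ξ‖ ^ 2) ^ (|s| / 2) :=
        Real.rpow_le_rpow_of_exponent_le h1 (by linarith [le_abs_self s])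
    _ ≤ ((1 + ‖ξ‖) ^ 2) ^ (|s| / 2) := by
        refine Real.rpow_le_rpow (by positivity) ?_ (by positivity)
        nlinarith [norm_nonneg ξ]
    _ = _ := by
        rw [← Real.rpow_natCast, ← Real.rpow_mul (by positivity)]
        congr 1
        push_cast
        ring

/-- With `a = (1 + ‖ξ‖)^{-(d+1)} ≤ 1`, Young's inequality gives `a‖G‖ ≤ a² + ‖G‖² ≤ a + ‖G‖²`. Both
terms are integrable, and the remaining `|s|` powers absorb the weight. -/
theorem integrable_weight_mul_norm {s : ℝ} (G : Lp (Cd d) 2 (volume : Measure (Rd d))) {M : ℕ}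
    (hM : |s| + d + 1 ≤ M) :
    Integrable fun ξ => ((1 + ‖ξ‖) ^ M)⁻¹ * ‖weight s ξ • G ξ‖ := by
  have h1 : Integrable fun ξ : Rd d => (1 + ‖ξ‖) ^ (-((d : ℝ) + 1)) :=
    integrable_one_add_norm (by simp)
  have h2 : Integrable fun ξ => ‖G ξ‖ ^ 2 := (Lp.memLp G).integrable_norm_pow (by norm_num)
  refine (h1.add h2).mono' ?_ (Eventually.of_forall fun ξ => ?_)
  · have hpos : ∀ ξ : Rd d, (1 + ‖ξ‖) ^ M ≠ 0 := fun ξ => by positivity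
    have h3 : Continuous fun ξ : Rd d => ((1 + ‖ξ‖) ^ M)⁻¹ := Continuous.inv₀ (by fun_prop) hpos
    exact h3.aestronglyMeasurable.mul
      ((continuous_weight s).aestronglyMeasurable.smul (Lp.aestronglyMeasurable G)).norm
  · have hb : (1 : ℝ) ≤ 1 + ‖ξ‖ := by linarith [norm_nonneg ξ]
    have h4 : ((1 + ‖ξ‖) ^ M)⁻¹ * weight s ξ ≤ (1 + ‖ξ‖) ^ (-((d : ℝ) + 1)) := by
      rw [← Real.rpow_natCast, ← Real.rpow_neg (by positivity)]
      calc _ ≤ (1 + ‖ξ‖) ^ (-(M : ℝ)) * (1 + ‖ξ‖) ^ |s| := by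
            gcongr
            exact weight_le_rpow s ξ
        _ = (1 + ‖ξ‖) ^ (-(M : ℝ) + |s|) := (Real.rpow_add (by positivity) _ _).symm
        _ ≤ _ := Real.rpow_le_rpow_of_exponent_le hb (by linarith)
    have h5 : (1 + ‖ξ‖) ^ (-((d : ℝ) + 1)) ≤ 1 :=
      Real.rpow_le_one_of_one_le_of_nonpos hb (by have := d.cast_nonneg (α := ℝ); linarith)
    have h6 : 0 ≤ (1 + ‖ξ‖) ^ (-((d : ℝ) + 1)) := by positivity
    rw [Real.norm_of_nonneg (by positivity), norm_smul, Real.norm_of_nonneg (weight_pos s ξ).le,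
      ← mul_assoc]
    simp only [Pi.add_apply]
    calc _ ≤ (1 + ‖ξ‖) ^ (-((d : ℝ) + 1)) * ‖G ξ‖ := by gcongr
      _ ≤ _ := by
        set a := (1 + ‖ξ‖) ^ (-((d : ℝ) + 1))
        nlinarith [sq_nonneg (a - ‖G ξ‖), mul_nonneg h6 (norm_nonneg (G ξ)), sq_nonneg ‖G ξ‖]

end Growth

/-! ### Pairing the wave with test functions on the Fourier side. -/

section Pairing

variable {d : ℕ} {W : Rd d → ℝ} {F₀ F₁ : Rd d → Cd d} {M : ℕ}

/-- The Fourier transform `cos(W t) F₀ + sin(W t)/W F₁` of the solution. -/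
def waveFourier (W : Rd d → ℝ) (F₀ F₁ : Rd d → Cd d) (t : ℝ) (ξ : Rd d) : Cd d :=
  Real.cos (W ξ * t) • F₀ ξ + sinDiv (W ξ) t • F₁ ξ

/-- The majorant `(1 + |ξ|)^{-M} (|F₀| + |F₁|)`. -/
def dataMajorant (M : ℕ) (F₀ F₁ : Rd d → Cd d) (ξ : Rd d) : ℝ :=
  ((1 + ‖ξ‖) ^ M)⁻¹ * ‖F₀ ξ‖ + ((1 + ‖ξ‖) ^ M)⁻¹ * ‖F₁ ξ‖

theorem dataMajorant_nonneg (M : ℕ) (F₀ F₁ : Rd d → Cd d) (ξ : Rd d) :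
    0 ≤ dataMajorant M F₀ F₁ ξ := by
  unfold dataMajorant
  positivity

theorem norm_waveFourier_le (t : ℝ) (ξ : Rd d) :
    ‖waveFourier W F₀ F₁ t ξ‖ ≤ (1 + |t|) * (‖F₀ ξ‖ + ‖F₁ ξ‖) := by
  calc ‖waveFourier W F₀ F₁ t ξ‖ ≤ |Real.cos (W ξ * t)| * ‖F₀ ξ‖ + |sinDiv (W ξ) t| * ‖F₁ ξ‖ := by
        refine (norm_add_le _ _).trans ?_
        rw [norm_smul, norm_smul, Real.norm_eq_abs, Real.norm_eq_abs]
    _ ≤ 1 * ‖F₀ ξ‖ + |t| * ‖F₁ ξ‖ := by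
        exact add_le_add
          (mul_le_mul_of_nonneg_right (Real.abs_cos_le_one _) (norm_nonneg _))
          (mul_le_mul_of_nonneg_right (abs_sinDiv_le _ _) (norm_nonneg _))
    _ ≤ _ := by nlinarith [norm_nonneg (F₀ ξ), norm_nonneg (F₁ ξ), abs_nonneg t,
        mul_nonneg (abs_nonneg t) (norm_nonneg (F₀ ξ))]

theorem norm_smul_waveFourier_le {z : ℂ} {t B T : ℝ} {ξ : Rd d} (hB : (1 + ‖ξ‖) ^ M * ‖z‖ ≤ B)
    (hT : |t| ≤ T) :
    ‖z • waveFourier W F₀ F₁ t ξ‖ ≤ B * (1 + T) * dataMajorant M F₀ F₁ ξ := by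
  have hpos : 0 < (1 + ‖ξ‖) ^ M := by positivity
  have hz : ‖z‖ ≤ B * ((1 + ‖ξ‖) ^ M)⁻¹ := by
    rw [← div_eq_mul_inv, le_div_iff₀ hpos, mul_comm]
    exact hB
  have hB0 : 0 ≤ B := le_trans (by positivity) hB
  have hT0 : 0 ≤ T := (abs_nonneg t).trans hT
  rw [norm_smul]
  calc ‖z‖ * ‖waveFourier W F₀ F₁ t ξ‖
      ≤ (B * ((1 + ‖ξ‖) ^ M)⁻¹) * ((1 + T) * (‖F₀ ξ‖ + ‖F₁ ξ‖)) := by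
        gcongr
        refine (norm_waveFourier_le t ξ).trans ?_
        gcongr
    _ = _ := by
        rw [dataMajorant]
        ring

/-- The majorant is a product of a function of `t` and a function of `ξ`. It serves both for Fubini
and for the continuity of the distribution, since it is linear in the bound `B` on the test
function. -/
theorem norm_sliceFourier_smul_waveFourier_le {φ : ℝ × Rd d → ℝ} {B T : ℝ}
    (hB : ∀ t ξ, (1 + ‖ξ‖) ^ M * ‖sliceFourier φ t ξ‖ ≤ B) (hT : ∀ p ∈ tsupport φ, |p.1| ≤ T)
    (t : ℝ) (ξ : Rd d) :
    ‖sliceFourier φ t ξ • waveFourier W F₀ F₁ t ξ‖ ≤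
      (Icc (-T) T).indicator (fun _ => B * (1 + T)) t * dataMajorant M F₀ F₁ ξ := by
  by_cases ht : t ∈ Icc (-T) T
  · rw [indicator_of_mem ht]
    exact norm_smul_waveFourier_le (hB t ξ) (abs_le.mpr ht)
  · rw [indicator_of_notMem ht, sliceFourier_eq_zero, zero_smul, norm_zero, zero_mul]
    rintro ⟨p, hp, rfl⟩
    exact ht (abs_le.mp (hT p hp))

theorem exists_abs_fst_le {φ : ℝ × Rd d → ℝ} (hc : HasCompactSupport φ) :
    ∃ T, ∀ p ∈ tsupport φ, |p.1| ≤ T := by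
  obtain ⟨T, -, hT⟩ := hc.isCompact.isBounded.exists_pos_norm_le
  exact ⟨T, fun p hp => (norm_fst_le p).trans (hT p hp)⟩

theorem aestronglyMeasurable_waveFourier_prod (hW : Continuous W)
    (hF₀ : AEStronglyMeasurable F₀ volume) (hF₁ : AEStronglyMeasurable F₁ volume)
    (μ : Measure ℝ) [SFinite μ] :
    AEStronglyMeasurable (fun q : ℝ × Rd d => waveFourier W F₀ F₁ q.1 q.2) (μ.prod volume) := by
  have h0 : Continuous fun q : ℝ × Rd d => Real.cos (W q.2 * q.1) := by fun_prop
  have h1 : Continuous fun q : ℝ × Rd d => sinDiv (W q.2) q.1 :=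
    continuous_sinDiv.comp ((hW.comp continuous_snd).prodMk continuous_fst)
  exact (h0.aestronglyMeasurable.smul hF₀.comp_snd).add (h1.aestronglyMeasurable.smul hF₁.comp_snd)

theorem integrable_indicator_mul_dataMajorant (hM : Integrable (dataMajorant M F₀ F₁)) (B T : ℝ) :
    Integrable (fun q : ℝ × Rd d =>
      (Icc (-T) T).indicator (fun _ => B * (1 + T)) q.1 * dataMajorant M F₀ F₁ q.2)
      ((volume.restrict (Ioi 0)).prod volume) := by
  refine Integrable.mul_prod (Integrable.restrict ?_) hM
  exact (integrable_indicator_iff measurableSet_Icc).mpr (integrableOn_const measure_Icc_lt_top.ne)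

theorem integrable_sliceFourier_smul_waveFourier (hW : Continuous W)
    (hF₀ : AEStronglyMeasurable F₀ volume) (hF₁ : AEStronglyMeasurable F₁ volume)
    (hM : Integrable (dataMajorant M F₀ F₁)) (φ : 𝓓(whole (ℝ × Rd d), ℝ)) :
    Integrable (fun q : ℝ × Rd d => sliceFourier φ q.1 q.2 • waveFourier W F₀ F₁ q.1 q.2)
      ((volume.restrict (Ioi 0)).prod volume) := by
  obtain ⟨B, -, hB⟩ := exists_sliceFourier_le_of_testFunction φ M
  obtain ⟨T, hT⟩ := exists_abs_fst_le φ.hasCompactSupport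
  refine (integrable_indicator_mul_dataMajorant hM B T).mono' ?_ (Eventually.of_forall fun q =>
    norm_sliceFourier_smul_waveFourier_le hB hT q.1 q.2)
  exact (continuous_sliceFourier φ.continuous φ.hasCompactSupport).aestronglyMeasurable.smul
    (aestronglyMeasurable_waveFourier_prod hW hF₀ hF₁ _)

theorem norm_integral_integral_le (hM : Integrable (dataMajorant M F₀ F₁)) {φ : ℝ × Rd d → ℝ}
    {B T : ℝ} (hB : ∀ t ξ, (1 + ‖ξ‖) ^ M * ‖sliceFourier φ t ξ‖ ≤ B)
    (hT : ∀ p ∈ tsupport φ, |p.1| ≤ T) :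
    ∫ t in Ioi (0 : ℝ), ‖∫ ξ, sliceFourier φ t ξ • waveFourier W F₀ F₁ t ξ‖ ≤
      B * ((1 + T) * ((volume.restrict (Ioi (0 : ℝ))).real (Icc (-T) T) *
        ∫ ξ, dataMajorant M F₀ F₁ ξ)) := by
  have hbound : ∀ t, ‖∫ ξ, sliceFourier φ t ξ • waveFourier W F₀ F₁ t ξ‖ ≤
      (Icc (-T) T).indicator (fun _ => B * (1 + T)) t * ∫ ξ, dataMajorant M F₀ F₁ ξ := by
    intro t
    rw [← integral_const_mul]
    exact norm_integral_le_of_norm_le (hM.const_mul _) (Eventually.of_forall fun ξ =>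
      norm_sliceFourier_smul_waveFourier_le hB hT t ξ)
  refine (integral_mono_of_nonneg (Eventually.of_forall fun t => norm_nonneg _) ?_
    (Eventually.of_forall hbound)).trans_eq ?_
  · refine Integrable.mul_const (Integrable.restrict ?_) _
    exact (integrable_indicator_iff measurableSet_Icc).mpr
      (integrableOn_const measure_Icc_lt_top.ne)
  · rw [integral_mul_const, integral_indicator measurableSet_Icc, setIntegral_const, smul_eq_mul]
    ring

/-- Integration by parts in time, at a fixed frequency. -/
theorem integral_sliceFourier_smul_waveFourier (φ ψ : 𝓓(whole (ℝ × Rd d), ℝ)) (ξ : Rd d)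
    (hψ : ∀ t, sliceFourier ψ t ξ =
      sliceFourier (timeDeriv (timeDeriv φ)) t ξ + (W ξ : ℂ) ^ 2 * sliceFourier φ t ξ) :
    ∫ t in Ioi (0 : ℝ), sliceFourier ψ t ξ • waveFourier W F₀ F₁ t ξ =
      -(sliceFourier (timeDeriv φ) 0 ξ • F₀ ξ) + sliceFourier φ 0 ξ • F₁ ξ := by
  set ω := W ξ with hω
  -- This is `û ∂_tφ̂ - (∂_tû) φ̂`, with `û` the wave and `φ̂` the slice transform. Since `û'' =
  -- -ω²û`, its derivative is `û (∂_ttφ̂ + ω²φ̂)`; it vanishes for large `t`, and at `t = 0` it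
  -- gives the initial data.
  set f : ℝ → Cd d := fun t =>
    ((Real.cos (ω * t) : ℂ) * sliceFourier (timeDeriv φ) t ξ +
      ((ω * Real.sin (ω * t) : ℝ) : ℂ) * sliceFourier φ t ξ) • F₀ ξ +
    ((sinDiv ω t : ℂ) * sliceFourier (timeDeriv φ) t ξ -
      (Real.cos (ω * t) : ℂ) * sliceFourier φ t ξ) • F₁ ξ with hf
  have hderiv : ∀ t, HasDerivAt f (sliceFourier ψ t ξ • waveFourier W F₀ F₁ t ξ) t := by
    intro t
    have h0 := hasDerivAt_sliceFourier φ t ξ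
    have h1 := hasDerivAt_sliceFourier (timeDeriv φ) t ξ
    have hc := (hasDerivAt_cos_mul ω t).ofReal_comp
    have hsd := (hasDerivAt_sinDiv ω t).ofReal_comp
    have hs : HasDerivAt (fun t => ((ω * Real.sin (ω * t) : ℝ) : ℂ))
        ((ω * (Real.cos (ω * t) * ω) : ℝ) : ℂ) t := by
      have h2 : HasDerivAt (fun t => Real.sin (ω * t)) (Real.cos (ω * t) * (ω * 1)) t :=
        ((hasDerivAt_id t).const_mul ω).sin
      rw [mul_one] at h2
      exact (h2.const_mul ω).ofReal_comp
    refine ((((hc.mul h1).add (hs.mul h0)).smul_const (F₀ ξ)).add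
      (((hsd.mul h1).sub (hc.mul h0)).smul_const (F₁ ξ))).congr_deriv ?_
    have hsin : (ω : ℂ) * (sinDiv ω t : ℂ) = (Real.sin (ω * t) : ℂ) := by
      exact_mod_cast mul_sinDiv ω t
    rw [waveFourier, hψ, ← Complex.coe_smul, ← Complex.coe_smul, ← hω, smul_add, smul_smul,
      smul_smul]
    congr 2
    · push_cast
      ring
    · push_cast at hsin ⊢
      linear_combination (-(ω : ℂ) * sliceFourier φ t ξ) * hsin
  obtain ⟨T, hT⟩ := exists_abs_fst_le φ.hasCompactSupport
  obtain ⟨T', hT'⟩ := exists_abs_fst_le ψ.hasCompactSupport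
  obtain ⟨T'', hT''⟩ := exists_abs_fst_le (timeDeriv φ).hasCompactSupport
  have hzero : ∀ {θ : ℝ × Rd d → ℝ} {S : ℝ}, (∀ p ∈ tsupport θ, |p.1| ≤ S) → ∀ t, S < |t| →
      sliceFourier θ t ξ = 0 := by
    intro θ S hS t ht
    refine sliceFourier_eq_zero ?_ ξ
    rintro ⟨p, hp, rfl⟩
    exact absurd (hS p hp) (not_le.mpr ht)
  have hcont : Continuous fun t => sliceFourier ψ t ξ • waveFourier W F₀ F₁ t ξ := by
    have h1 : Continuous fun t => sliceFourier ψ t ξ :=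
      continuous_iff_continuousAt.mpr fun t => (hasDerivAt_sliceFourier ψ t ξ).continuousAt
    have h2 : Continuous (sinDiv ω) :=
      continuous_iff_continuousAt.mpr fun t => (hasDerivAt_sinDiv ω t).continuousAt
    have h3 : Continuous fun t => Real.cos (ω * t) := by fun_prop
    exact h1.smul ((h3.smul continuous_const).add (h2.smul continuous_const))
  have hint : Integrable fun t => sliceFourier ψ t ξ • waveFourier W F₀ F₁ t ξ := by
    refine hcont.integrable_of_hasCompactSupport (HasCompactSupport.intro (K := Icc (-T') T')
      isCompact_Icc fun t ht => ?_)
    rw [hzero hT' t (not_le.mp fun h => ht (abs_le.mp h)), zero_smul]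
  have hlim : Tendsto f atTop (𝓝 0) := by
    refine tendsto_const_nhds.congr' ?_
    filter_upwards [eventually_gt_atTop T, eventually_gt_atTop T''] with t h1 h2
    rw [hf]
    simp only
    rw [hzero hT t (h1.trans_le (le_abs_self t)), hzero hT'' t (h2.trans_le (le_abs_self t))]
    simp
  rw [integral_Ioi_of_hasDerivAt_of_tendsto (hderiv 0).continuousAt.continuousWithinAt
    (fun t _ => hderiv t) hint.integrableOn hlim, hf]
  simp [sinDiv_zero_right, add_comm]

end Pairing

/-! ### The space-time distribution and the weak equation. -/

section Distribution

variable {d : ℕ} {s α : ℝ} {W : Rd d → ℝ}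

/-- The Fourier transform `(1 + |ξ|²)^{-s/2} G` of the element of `H^s` with profile `G`. -/
def Hs.fourierFun (u : Hs d s) (ξ : Rd d) : Cd d := weight (-s) ξ • u.profile ξ

theorem Hs.aestronglyMeasurable_fourierFun (u : Hs d s) :
    AEStronglyMeasurable u.fourierFun volume :=
  (continuous_weight (-s)).aestronglyMeasurable.smul (Lp.aestronglyMeasurable u.profile)

theorem Hs.toTempered_slice (u : Hs d s) (φ : 𝓓(whole (ℝ × Rd d), ℝ)) (t : ℝ) :
    Integrable (fun ξ => sliceFourier φ t ξ • u.fourierFun ξ) ∧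
      u.toTempered (testToSchwartz d (slice φ t)) =
        ∫ ξ, sliceFourier φ t ξ • u.fourierFun ξ := by
  have h : (fun ξ => ((weight (-s) ξ : ℂ) * 𝓕⁻ (testToSchwartz d (slice φ t)) ξ) • u.profile ξ) =
      fun ξ => sliceFourier φ t ξ • u.fourierFun ξ := by
    ext1 ξ
    rw [fourierInv_testToSchwartz_slice, Hs.fourierFun, ← Complex.coe_smul, smul_smul, mul_comm]
  rw [← h]
  exact ⟨u.integrable_profile _, u.toTempered_apply _⟩

theorem exists_integrable_dataMajorant (u₀ : Hs d s) (v₀ : Hs d (s - α)) :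
    ∃ M, Integrable (dataMajorant M u₀.fourierFun v₀.fourierFun) := by
  obtain ⟨M, hM⟩ := exists_nat_ge (max (|-s| + d + 1) (|-(s - α)| + d + 1))
  exact ⟨M, (integrable_weight_mul_norm u₀.profile ((le_max_left _ _).trans hM)).add
    (integrable_weight_mul_norm v₀.profile ((le_max_right _ _).trans hM))⟩

theorem fourierFun_evolution (hW : IsDispersion α W) (u₀ : Hs d s) (v₀ : Hs d (s - α)) (t : ℝ) :
    (evolution hW u₀ v₀ t).fourierFun =ᵐ[volume]
      waveFourier W u₀.fourierFun v₀.fourierFun t := by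
  have h := hW.coeFn_evolutionProfile u₀.profile v₀.profile t
  rw [← profile_evolution hW u₀ v₀ t] at h
  filter_upwards [h] with ξ hξ
  have hw : weight (-s) ξ * weight α ξ = weight (-(s - α)) ξ := by
    rw [weight_mul_weight]
    congr 1
    ring
  simp only [Hs.fourierFun, waveFourier]
  rw [hξ, smul_add, smul_smul, smul_smul, smul_smul, smul_smul, ← hw]
  congr 2 <;> ring

theorem toDistribution_apply (u : 𝓢'(Rd d, Cd d)) (φ : 𝓓(whole (Rd d), ℝ)) :
    toDistribution u φ = rePart d (u (testToSchwartz d φ)) := rfl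

theorem toDistribution_evolution_slice (hW : IsDispersion α W) (u₀ : Hs d s) (v₀ : Hs d (s - α))
    (φ : 𝓓(whole (ℝ × Rd d), ℝ)) (t : ℝ) :
    toDistribution (evolution hW u₀ v₀ t).toTempered (slice φ t) =
      rePart d (∫ ξ, sliceFourier φ t ξ • waveFourier W u₀.fourierFun v₀.fourierFun t ξ) := by
  rw [toDistribution_apply, (Hs.toTempered_slice _ φ t).2]
  congr 1
  refine integral_congr_ae ?_
  filter_upwards [fourierFun_evolution hW u₀ v₀ t] with ξ hξ
  rw [hξ]

theorem integrable_slice_pairing (hW : IsDispersion α W) (u₀ : Hs d s) (v₀ : Hs d (s - α))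
    (φ : 𝓓(whole (ℝ × Rd d), ℝ)) :
    IntegrableOn (fun t => ∫ ξ, sliceFourier φ t ξ •
      waveFourier W u₀.fourierFun v₀.fourierFun t ξ) (Ioi 0) := by
  obtain ⟨M, hM⟩ := exists_integrable_dataMajorant u₀ v₀
  exact (integrable_sliceFourier_smul_waveFourier hW.continuous
    u₀.aestronglyMeasurable_fourierFun v₀.aestronglyMeasurable_fourierFun hM φ).integral_prod_left

theorem integrableOn_toDistribution_slice (hW : IsDispersion α W) (u₀ : Hs d s)
    (v₀ : Hs d (s - α)) (φ : 𝓓(whole (ℝ × Rd d), ℝ)) :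
    IntegrableOn (fun t => toDistribution (evolution hW u₀ v₀ t).toTempered (slice φ t))
      (Ioi 0) := by
  simp_rw [toDistribution_evolution_slice]
  exact (rePart d).integrable_comp (integrable_slice_pairing hW u₀ v₀ φ)

theorem slice_add (φ ψ : 𝓓(whole (ℝ × Rd d), ℝ)) (t : ℝ) :
    slice (φ + ψ) t = slice φ t + slice ψ t := rfl

theorem slice_smul (c : ℝ) (φ : 𝓓(whole (ℝ × Rd d), ℝ)) (t : ℝ) :
    slice (c • φ) t = c • slice φ t := rfl

theorem norm_rePart_le (z : Cd d) : ‖rePart d z‖ ≤ ‖rePart d‖ * ‖z‖ := (rePart d).le_opNorm z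

/-- The distribution on `ℝ × ℝ^d` defined by the evolution. -/
def evolutionDistribution (hW : IsDispersion α W) (u₀ : Hs d s) (v₀ : Hs d (s - α)) :
    𝓓'(whole (ℝ × Rd d), Rd d) :=
  TestFunction.mkCLM ℝ
    (fun φ => ∫ t in Ioi (0 : ℝ), toDistribution (evolution hW u₀ v₀ t).toTempered (slice φ t))
    (fun φ ψ => by
      simp_rw [slice_add, map_add]
      exact integral_add (integrableOn_toDistribution_slice hW u₀ v₀ φ)
        (integrableOn_toDistribution_slice hW u₀ v₀ ψ))
    (fun c φ => by
      simp_rw [slice_smul, map_smul]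
      exact integral_smul c _)
    (fun K hK => by
      let L : 𝓓_{K}(ℝ × Rd d, ℝ) →ₗ[ℝ] Rd d :=
        { toFun := fun f => ∫ t in Ioi (0 : ℝ), toDistribution (evolution hW u₀ v₀ t).toTempered
            (slice (TestFunction.ofSupportedIn hK f) t)
          map_add' := fun f g => by
            have h : TestFunction.ofSupportedIn hK (f + g) =
              TestFunction.ofSupportedIn hK f + TestFunction.ofSupportedIn hK g := rfl
            simp_rw [h, slice_add, map_add]
            exact integral_add (integrableOn_toDistribution_slice hW u₀ v₀ _)
              (integrableOn_toDistribution_slice hW u₀ v₀ _)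
          map_smul' := fun c f => by
            have h : TestFunction.ofSupportedIn hK (c • f) =
              c • TestFunction.ofSupportedIn hK f := rfl
            simp_rw [h, slice_smul, map_smul]
            exact integral_smul c _ }
      change Continuous L
      -- Continuity on functions supported in `K`: `M` is the decay needed to integrate the data,
      -- `C` and `S` control that decay by derivatives of `f`, and `T` bounds the times occurring in
      -- `K`.
      obtain ⟨M, hM⟩ := exists_integrable_dataMajorant u₀ v₀
      obtain ⟨C, S, hC, hCS⟩ := exists_sliceFourier_le K M
      obtain ⟨T, hT0, hT⟩ := K.isCompact.isBounded.exists_pos_norm_le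
      set A := (1 + T) * ((volume.restrict (Ioi (0 : ℝ))).real (Icc (-T) T) *
        ∫ ξ, dataMajorant M u₀.fourierFun v₀.fourierFun ξ) with hA
      have hA0 : 0 ≤ A := mul_nonneg (by linarith) (mul_nonneg measureReal_nonneg
        (integral_nonneg fun ξ => dataMajorant_nonneg M _ _ ξ))
      refine WithSeminorms.continuous_of_isBounded
        (ContDiffMapSupportedIn.withSeminorms ℝ (ℝ × Rd d) ℝ ⊤ K)
        (norm_withSeminorms ℝ (Rd d)) L fun _ => ?_
      refine ⟨S, ⟨‖rePart d‖ * (C * A), by positivity⟩, fun f => ?_⟩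
      set P := (S.sup (ContDiffMapSupportedIn.seminorm ℝ (ℝ × Rd d) ℝ ⊤ K)) f with hP
      set φ : 𝓓(whole (ℝ × Rd d), ℝ) := TestFunction.ofSupportedIn hK f with hφ
      have hint := integrable_slice_pairing hW u₀ v₀ φ
      have hle := norm_integral_integral_le (W := W) hM (φ := φ) (B := C * P) (T := T)
        (fun t ξ => hCS f t ξ) fun p hp => (norm_fst_le p).trans (hT p (f.tsupport_subset hp))
      calc ‖L f‖ = ‖∫ t in Ioi (0 : ℝ), rePart d (∫ ξ, sliceFourier φ t ξ •
            waveFourier W u₀.fourierFun v₀.fourierFun t ξ)‖ := by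
            simp_rw [← toDistribution_evolution_slice hW]
            rfl
        _ = ‖rePart d (∫ t in Ioi (0 : ℝ), ∫ ξ, sliceFourier φ t ξ •
            waveFourier W u₀.fourierFun v₀.fourierFun t ξ)‖ := by
            rw [ContinuousLinearMap.integral_comp_comm _ hint]
        _ ≤ ‖rePart d‖ * (C * P * A) := by
            refine (norm_rePart_le _).trans ?_
            gcongr
            exact (norm_integral_le_integral_norm _).trans hle
        _ = (‖rePart d‖ * (C * A)) * P := by ring)

theorem evolutionDistribution_apply (hW : IsDispersion α W) (u₀ : Hs d s) (v₀ : Hs d (s - α))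
    (φ : 𝓓(whole (ℝ × Rd d), ℝ)) :
    evolutionDistribution hW u₀ v₀ φ =
      ∫ t in Ioi (0 : ℝ), toDistribution (evolution hW u₀ v₀ t).toTempered (slice φ t) := rfl

theorem dsupport_evolutionDistribution_subset (hW : IsDispersion α W) (u₀ : Hs d s)
    (v₀ : Hs d (s - α)) :
    Distribution.dsupport (evolutionDistribution hW u₀ v₀) ⊆ Ici (0 : ℝ) ×ˢ (univ : Set (Rd d)) := by
  -- The support lies in every closed set off which the distribution vanishes. A test function
  -- supported off the closed half-space has zero slices at all `t > 0`.
  refine sInter_subset_of_mem ⟨fun φ hφ => ?_, isClosed_Ici.prod isClosed_univ⟩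
  rw [evolutionDistribution_apply]
  refine setIntegral_eq_zero_of_forall_eq_zero fun t ht => ?_
  have h0 : slice φ t = 0 := by
    ext x
    change φ (t, x) = 0
    exact image_eq_zero_of_notMem_tsupport (f := φ) (x := (t, x)) fun hmem =>
      hφ hmem ⟨(mem_Ioi.mp ht).le, trivial⟩
  rw [h0, map_zero]

theorem sliceFourier_sub {φ ψ : ℝ × Rd d → ℝ} (hφ : Continuous φ) (hφc : HasCompactSupport φ)
    (hψ : Continuous ψ) (hψc : HasCompactSupport ψ) (t : ℝ) (ξ : Rd d) :
    sliceFourier (fun p => φ p - ψ p) t ξ = sliceFourier φ t ξ - sliceFourier ψ t ξ := by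
  have h1 : Continuous fun x => φ (t, x) := by fun_prop
  have h2 : Continuous fun x => ψ (t, x) := by fun_prop
  rw [sliceFourier, sliceFourier, sliceFourier, ← integral_sub
    (integrable_character_mul h1 (hasCompactSupport_slice hφc t) ξ)
    (integrable_character_mul h2 (hasCompactSupport_slice hψc t) ξ)]
  congr 1 with x
  push_cast
  ring

/-- The test function `∂_tt φ - K^*[φ]`. -/
def dualWaveOperator {k : Rd d → ℝ} {r : ℝ} (hk : IsEvenKernel k r)
    (φ : 𝓓(whole (ℝ × Rd d), ℝ)) : 𝓓(whole (ℝ × Rd d), ℝ) :=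
  ⟨fun p => timeDeriv (timeDeriv φ) p - nonlocalOp k φ p,
    (timeDeriv (timeDeriv φ)).contDiff.sub (hk.contDiff_nonlocalOp φ.contDiff φ.hasCompactSupport),
    (timeDeriv (timeDeriv φ)).hasCompactSupport.sub
      (hk.hasCompactSupport_nonlocalOp φ.hasCompactSupport),
    fun _ _ => trivial⟩

theorem dualWaveOperator_apply {k : Rd d → ℝ} {r : ℝ} (hk : IsEvenKernel k r)
    (φ : 𝓓(whole (ℝ × Rd d), ℝ)) (p : ℝ × Rd d) :
    dualWaveOperator hk φ p = timeDeriv (timeDeriv φ) p - nonlocalOp k φ p := rfl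

theorem contDiff_two (φ : 𝓓(whole (ℝ × Rd d), ℝ)) : ContDiff ℝ 2 φ := by
  exact_mod_cast contDiff_infty.mp φ.contDiff 2

theorem sliceFourier_dualWaveOperator {k : Rd d → ℝ} {r : ℝ} (hk : IsEvenKernel k r)
    (φ : 𝓓(whole (ℝ × Rd d), ℝ)) (t : ℝ) (ξ : Rd d) :
    sliceFourier (dualWaveOperator hk φ) t ξ = sliceFourier (timeDeriv (timeDeriv φ)) t ξ +
      (symbol k ((2 * Real.pi) • ξ) : ℂ) * sliceFourier φ t ξ := by
  have h := sliceFourier_sub (timeDeriv (timeDeriv φ)).continuous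
    (timeDeriv (timeDeriv φ)).hasCompactSupport
    (hk.contDiff_nonlocalOp φ.contDiff φ.hasCompactSupport).continuous
    (hk.hasCompactSupport_nonlocalOp φ.hasCompactSupport) t ξ
  rw [hk.sliceFourier_nonlocalOp (contDiff_two φ) φ.hasCompactSupport] at h
  exact h.trans (by ring)

/-- The relation `W² = symbol` turns the dual operator into the adjoint oscillator at each
frequency. Fubini brings the time integral inside, where integration by parts applies, and the
boundary terms are the Fourier pairings of the data. -/
theorem evolutionDistribution_dualWaveOperator (hW : IsDispersion α W) {k : Rd d → ℝ} {r : ℝ}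
    (hk : IsEvenKernel k r) (hsymb : ∀ ξ, W ξ ^ 2 = symbol k ((2 * Real.pi) • ξ)) (u₀ : Hs d s)
    (v₀ : Hs d (s - α)) (φ : 𝓓(whole (ℝ × Rd d), ℝ)) :
    evolutionDistribution hW u₀ v₀ (dualWaveOperator hk φ) =
      -toDistribution u₀.toTempered (slice (timeDeriv φ) 0) +
        toDistribution v₀.toTempered (slice φ 0) := by
  obtain ⟨M, hM⟩ := exists_integrable_dataMajorant u₀ v₀
  set ψ := dualWaveOperator hk φ with hψ
  obtain ⟨h0, h0'⟩ := u₀.toTempered_slice (timeDeriv φ) 0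
  obtain ⟨h1, h1'⟩ := v₀.toTempered_slice φ 0
  have hparts : ∀ ξ, ∫ t in Ioi (0 : ℝ), sliceFourier ψ t ξ •
      waveFourier W u₀.fourierFun v₀.fourierFun t ξ =
      -(sliceFourier (timeDeriv φ) 0 ξ • u₀.fourierFun ξ) + sliceFourier φ 0 ξ • v₀.fourierFun ξ :=
    fun ξ => integral_sliceFourier_smul_waveFourier φ ψ ξ fun t => by
      rw [hψ, sliceFourier_dualWaveOperator, ← hsymb]
      push_cast
      rfl
  rw [evolutionDistribution_apply]
  simp_rw [toDistribution_evolution_slice]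
  rw [ContinuousLinearMap.integral_comp_comm _ (integrable_slice_pairing hW u₀ v₀ ψ),
    integral_integral_swap (integrable_sliceFourier_smul_waveFourier hW.continuous
      u₀.aestronglyMeasurable_fourierFun v₀.aestronglyMeasurable_fourierFun hM ψ)]
  simp_rw [hparts]
  have h0n : Integrable fun ξ => -(sliceFourier (timeDeriv φ) 0 ξ • u₀.fourierFun ξ) := h0.neg
  rw [integral_add h0n h1, integral_neg, map_add, map_neg, ← h0', ← h1']
  rfl

/-- The Fourier transform of an element of `H^s` in angular frequency. -/
def Hs.angularFourier (u : Hs d s) (ζ : Rd d) : Cd d :=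
  (((2 * Real.pi) ^ (-(d : ℝ) / 2) : ℝ) : ℂ) • u.fourierFun ((2 * Real.pi)⁻¹ • ζ)

theorem Hs.isGivenBy_angularFourier (u : Hs d s) :
    IsGivenBy (fourierT d u.toTempered) u.angularFourier :=
  u.isGivenBy_fourierT

theorem IsGivenBy.congr {T : 𝓢'(Rd d, Cd d)} {f g : Rd d → Cd d} (h : IsGivenBy T f)
    (hfg : f =ᵐ[volume] g) : IsGivenBy T g := by
  intro ψ
  have h1 : (fun x => ψ x • f x) =ᵐ[volume] fun x => ψ x • g x := by
    filter_upwards [hfg] with x hx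
    rw [hx]
  exact ⟨(h ψ).1.congr h1, (h ψ).2.trans (integral_congr_ae h1)⟩

theorem ae_inv_smul {a : ℝ} (ha : a ≠ 0) {p : Rd d → Prop} (h : ∀ᵐ ξ, p ξ) : ∀ᵐ ζ, p (a⁻¹ • ζ) := by
  have h1 : {ζ : Rd d | ¬ p (a⁻¹ • ζ)} = (a⁻¹ • ·) ⁻¹' {ξ | ¬ p ξ} := rfl
  rw [ae_iff, h1, Measure.addHaar_preimage_smul _ (inv_ne_zero ha), ae_iff.mp h, mul_zero]

theorem isGivenBy_fourierT_evolution (hW : IsDispersion α W) (u₀ : Hs d s) (v₀ : Hs d (s - α))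
    (t : ℝ) :
    IsGivenBy (fourierT d (evolution hW u₀ v₀ t).toTempered) fun ζ =>
      Real.cos (W ((2 * Real.pi)⁻¹ • ζ) * t) • u₀.angularFourier ζ +
        sinDiv (W ((2 * Real.pi)⁻¹ • ζ)) t • v₀.angularFourier ζ := by
  refine (Hs.isGivenBy_angularFourier _).congr ?_
  filter_upwards [ae_inv_smul (by positivity : 2 * Real.pi ≠ 0)
    (fourierFun_evolution hW u₀ v₀ t)] with ζ hζ
  simp only [Hs.angularFourier]
  rw [hζ, waveFourier, smul_add, smul_comm, smul_comm _ (sinDiv _ _)]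

end Distribution

end Peridynamics

end

/-! ### The theorem. -/

open Peridynamics in
theorem theorem1p1 (d : ℕ) (hd : 1 ≤ d) (κ α δ : ℝ) (hκ : 0 < κ) (hα₀ : 0 < α) (hα₁ : α < 1)
    (hδ : 0 < δ) (χ : ℝ → ℝ) (hχ : IsCutoff χ) (s : ℝ) (u₀ : Hs d s) (v₀ : Hs d (s - α)) :
    ∃ u : ℝ → Hs d s,
      ContinuousOn u (Ici 0) ∧
      ContDiffOn ℝ 1 (fun t => Hs.incl (sub_le_self s hα₀.le) (u t)) (Ioi 0) ∧
      (∃ f g : Rd d → Cd d,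
        IsGivenBy (fourierT d u₀.toTempered) f ∧
        IsGivenBy (fourierT d v₀.toTempered) g ∧
        ∀ t : ℝ, 0 ≤ t → IsGivenBy (fourierT d (u t).toTempered) (fun ξ =>
          Real.cos (dispersion κ α δ χ ξ * t) • f ξ + sinDiv (dispersion κ α δ χ ξ) t • g ξ)) ∧
      ∃ U : 𝓓'(whole (ℝ × Rd d), Rd d),
        InducesDistribution u U ∧
        IsDistributionalSolution κ α δ χ (toDistribution u₀.toTempered)
          (toDistribution v₀.toTempered) U := by
  have hW := isDispersion_dispersion (d := d) hd hκ hα₀ hα₁ hδ hχ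
  have hk := isEvenKernel_kernel (d := d) hd hκ hα₀ hα₁ hδ hχ
  refine ⟨evolution hW u₀ v₀, (continuous_evolution hW u₀ v₀).continuousOn,
    (contDiff_incl_evolution hα₀.le hW u₀ v₀).contDiffOn,
    ⟨u₀.angularFourier, v₀.angularFourier, u₀.isGivenBy_angularFourier,
      v₀.isGivenBy_angularFourier, fun t _ => ?_⟩,
    evolutionDistribution hW u₀ v₀,
    fun φ => ⟨integrableOn_toDistribution_slice hW u₀ v₀ φ, rfl⟩,
    dsupport_evolutionDistribution_subset hW u₀ v₀, fun φ => ⟨dualWaveOperator hk φ, ?_, ?_⟩⟩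
  -- The factor `2π` in `W` cancels the dilation by `(2π)⁻¹` from the angular normalization, leaving
  -- `ω` at the angular frequency itself.
  · have h := isGivenBy_fourierT_evolution hW u₀ v₀ t
    simpa only [smul_smul, mul_inv_cancel₀ (by positivity : 2 * Real.pi ≠ 0), one_smul] using h
  · intro t x
    rw [dualWaveOperator_apply, sub_sub_cancel]
    exact hk.tendsto_nonlocalOp (contDiff_two φ) φ.hasCompactSupport t x
  · exact evolutionDistribution_dualWaveOperator hW hk
      (fun ξ => Real.sq_sqrt (hk.symbol_nonneg _)) u₀ v₀ φ
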